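/- Let $\mathbb N=\mathbb Z_+=\{0,1,2,\dots\}$. The lower density of $A\subset\mathbb N$ is $\underline{\mathrm{dens}}(A)=\liminf_{N\to\infty}\frac{\#(A\cap[0,N])}{N+1}$. Let $T$ be a continuous linear operator on a topological vector space $X$, and for $x\in X$, $V\subset X$ put $\mathcal N_T(x,V)=\{n\in\mathbb N: T^nx\in V\}$. - $T$ is hypercyclic if some orbit $\{T^nx:n\ge0\}$ is dense in $X$, and chaotic if it is hypercyclic and its periodic points (the $x$ with $T^nx=x$ for some $n\ge1$) are dense in $X$. - $T$ is frequently hypercyclic if there is $x\in X$ such that $\underline{\mathrm{dens}}(\mathcal N_T(x,V))>0$ for every non-empty open $V\subset X$. - $T$ is frequently hypercyclic along $A\subset\mathbb N$ if there is $x\in X$ such that $\underline{\mathrm{dens}}(A\cap\mathcal N_T(x,V))>0$ for every non-empty open $V\subset X$. - $T$ is hereditarily frequently hypercyclic if for every countable family $(V_i)_{i\in I}$ of non-empty open subsets of $X$ and every family $(A_i)_{i\in I}$ of subsets of $\mathbb N$ with positive lower density there is $x\in X$ such that $\underline{\mathrm{dens}}(\mathcal N_T(x,V_i)\cap A_i)>0$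 for all $i\in I$. Let $(e_k)_{k\ge0}$ be the canonical basis of the complex space $\ell_p(\mathbb Z_+)$. A C-type operator on $\ell_p(\mathbb Z_+)$ is a bounded operator $T$ such that $$Te_k=\begin{cases} w_{k+1}e_{k+1} & \text{if } b_n\le k<b_{n+1}-1,\ n\ge 0,\\ v_n e_{b_{\varphi(n)}}-\Bigl(\prod_{b_n<j<b_{n+1}}w_j\Bigr)^{-1}e_{b_n} & \text{if } k=b_{n+1}-1,\ n\ge1,\\ -\Bigl(\prod_{b_0<j<b_1}w_j\Bigr)^{-1}e_0 & \text{if } k=b_1-1,\end{cases}$$ where $(v_n)_{n\ge1}$ is a sequence of non-zero complex numbers with $\sum_n|v_n|<\infty$; $(w_j)_{j\ge1}$ is a sequence of complex numbers with $0<\inf_j|w_j|\le\sup_j|w_j|<\infty$; $\varphi:\mathbb Z_+\to\mathbb Z_+$ satisfies $\varphi(0)=0$, $\varphi(n)<n$ for $n\ge1$, and every $\varphi^{-1}(l)$ is infinite; $(b_n)_{n\ge0}$ is a strictly increasing sequence of integers with $b_0=0$ such that $b_{n+1}-b_n$ is a multiple of $2(b_{\varphi(n)+1}-b_{\varphi(n)})$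 for all $n\ge1$; and $\inf_{n\ge0}\prod_{b_n<j<b_{n+1}}|w_j|>0$. It is of type $C_{+,1}$ if moreover there are sequences of non-negative integers $(\Delta^{(k)})_{k\ge1}$, $(\delta^{(k)})_{k\ge1}$, $(\tau^{(k)})_{k\ge1}$, with $(\delta^{(k)})$ and $(\tau^{(k)})$ strictly increasing and $\delta^{(k)}<\Delta^{(k)}$, such that for all $k\ge1$ and $n\in[2^{k-1},2^k)$: $\varphi(n)=n-2^{k-1}$, $b_{n+1}-b_n=\Delta^{(k)}$, $v_n=2^{-\tau^{(k)}}$, $w_{b_n+i}=2$ for $1\le i\le\delta^{(k)}$, and $w_{b_n+i}=1$ for $\delta^{(k)}<i<\Delta^{(k)}$. **Theorem.** Let $1\le p<\infty$. There exist an operator $T$ of type $C_{+,1}$ on $\ell_p(\mathbb Z_+)$ and a set $A\subset\mathbb N$ with $\underline{\mathrm{dens}}(A)>0$ such that $T$ is frequently hypercyclic and chaotic, but not frequently hypercyclic along $A$, and hence not hereditarily frequently hypercyclic. -/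

import Mathlib

open scoped ENNReal

namespace LinDyn

/-! ### Lower density and frequent hypercyclicity -/

/-- Lower density of `A ⊆ ℕ`: the lower limit of `#(A ∩ [0, N]) / (N + 1)` as `N → ∞`
(the quotients lie in `[0, 1]`, so the real lower limit is the true one). -/
noncomputable def lowerDensity (A : Set ℕ) : ℝ :=
  Filter.liminf (fun N : ℕ => ((A ∩ Set.Iic N).ncard : ℝ) / ((N : ℝ) + 1)) Filter.atTop

section Operators

variable {X : Type*} [AddCommGroup X] [Module ℂ X] [TopologicalSpace X]

/-- The visit set `{n : T ^ n x ∈ V}`. -/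
def visitSet (T : X →L[ℂ] X) (x : X) (V : Set X) : Set ℕ := {n | (T ^ n) x ∈ V}

/-- `T` has a dense orbit. -/
def IsHypercyclic (T : X →L[ℂ] X) : Prop :=
  ∃ x : X, Dense (Set.range fun n : ℕ => (T ^ n) x)

/-- `T` is chaotic: it is hypercyclic and its periodic points are dense. -/
def IsChaotic (T : X →L[ℂ] X) : Prop :=
  IsHypercyclic T ∧ Dense {x : X | ∃ n : ℕ, 0 < n ∧ (T ^ n) x = x}

/-- `T` is frequently hypercyclic. -/
def IsFrequentlyHypercyclic (T : X →L[ℂ] X) : Prop :=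
  ∃ x : X, ∀ V : Set X, IsOpen V → V.Nonempty → 0 < lowerDensity (visitSet T x V)

/-- `T` is frequently hypercyclic along the set `A`. -/
def IsFrequentlyHypercyclicAlong (T : X →L[ℂ] X) (A : Set ℕ) : Prop :=
  ∃ x : X, ∀ V : Set X, IsOpen V → V.Nonempty → 0 < lowerDensity (A ∩ visitSet T x V)

/-- `T` is hereditarily frequently hypercyclic. -/
def IsHereditarilyFrequentlyHypercyclic (T : X →L[ℂ] X) : Prop :=
  ∀ (I : Type) [Countable I] (V : I → Set X) (A : I → Set ℕ),
    (∀ i, IsOpen (V i)) → (∀ i, (V i).Nonempty) → (∀ i, 0 < lowerDensity (A i)) →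
      ∃ x : X, ∀ i, 0 < lowerDensity (visitSet T x (V i) ∩ A i)

end Operators

/-! ### C-type operators -/

/-- The parameters `v = (v_n)_{n ≥ 1}`, `w = (w_j)_{j ≥ 1}`, `φ`, `b` of a C-type operator.
The values `v 0` and `w 0` play no role. -/
structure CTypeParams where
  v : ℕ → ℂ
  w : ℕ → ℂ
  φ : ℕ → ℕ
  b : ℕ → ℕ
  v_ne_zero : ∀ n, 1 ≤ n → v n ≠ 0
  v_summable : Summable fun n : ℕ => ‖v (n + 1)‖
  w_bounded_below : ∃ c : ℝ, 0 < c ∧ ∀ j, 1 ≤ j → c ≤ ‖w j‖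
  w_bounded_above : ∃ C : ℝ, ∀ j, 1 ≤ j → ‖w j‖ ≤ C
  φ_zero : φ 0 = 0
  φ_lt : ∀ n, 1 ≤ n → φ n < n
  φ_fiber_infinite : ∀ l, {n | φ n = l}.Infinite
  b_zero : b 0 = 0
  b_strictMono : StrictMono b
  b_dvd : ∀ n, 1 ≤ n → 2 * (b (φ n + 1) - b (φ n)) ∣ b (n + 1) - b n
  prod_bounded_below :
    ∃ c : ℝ, 0 < c ∧ ∀ n, c ≤ ∏ j ∈ Finset.Ioo (b n) (b (n + 1)), ‖w j‖

/-- The product `∏_{b_n < j < b_{n+1}} w_j` of the weights inside the `n`-th block. -/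
noncomputable def CTypeParams.blockProd (P : CTypeParams) (n : ℕ) : ℂ :=
  ∏ j ∈ Finset.Ioo (P.b n) (P.b (n + 1)), P.w j

/-- `T` is the C-type operator on `ℓ_p(ℤ_+)` with parameters `P`, given by its values on the
canonical basis `e_k = lp.single p k 1`. -/
structure CTypeParams.IsOperator (P : CTypeParams) {p : ℝ≥0∞} [Fact (1 ≤ p)]
    (T : lp (fun _ : ℕ => ℂ) p →L[ℂ] lp (fun _ : ℕ => ℂ) p) : Prop where
  inside : ∀ n k : ℕ, P.b n ≤ k → k + 1 < P.b (n + 1) →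
    T (lp.single p k (1 : ℂ)) = P.w (k + 1) • lp.single p (k + 1) (1 : ℂ)
  last : ∀ n k : ℕ, 1 ≤ n → k + 1 = P.b (n + 1) →
    T (lp.single p k (1 : ℂ)) =
      P.v n • lp.single p (P.b (P.φ n)) (1 : ℂ)
        - (P.blockProd n)⁻¹ • lp.single p (P.b n) (1 : ℂ)
  last_zero : ∀ k : ℕ, k + 1 = P.b 1 →
    T (lp.single p k (1 : ℂ)) = -((P.blockProd 0)⁻¹ • lp.single p 0 (1 : ℂ))

/-- The parameters of an operator of type `C_+`; the sequences `Δ^{(k)}`, `v^{(k)}`, `w_i^{(k)}`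
are only relevant for `k ≥ 1` and `1 ≤ i < Δ^{(k)}`. -/
structure CPlusParams extends CTypeParams where
  Δ : ℕ → ℕ
  vv : ℕ → ℂ
  ww : ℕ → ℕ → ℂ
  φ_eq : ∀ k, 1 ≤ k → ∀ n ∈ Set.Ico (2 ^ (k - 1)) (2 ^ k), φ n = n - 2 ^ (k - 1)
  block_size : ∀ k, 1 ≤ k → ∀ n ∈ Set.Ico (2 ^ (k - 1)) (2 ^ k), b (n + 1) - b n = Δ k
  v_eq : ∀ k, 1 ≤ k → ∀ n ∈ Set.Ico (2 ^ (k - 1)) (2 ^ k), v n = vv k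
  w_eq : ∀ k, 1 ≤ k → ∀ n ∈ Set.Ico (2 ^ (k - 1)) (2 ^ k),
    ∀ i, 1 ≤ i → i < Δ k → w (b n + i) = ww k i

/-- The parameters of an operator of type `C_{+,1}`. -/
structure CPlusOneParams extends CPlusParams where
  τ : ℕ → ℕ
  δ : ℕ → ℕ
  τ_strictMono : StrictMonoOn τ (Set.Ici 1)
  δ_strictMono : StrictMonoOn δ (Set.Ici 1)
  δ_lt : ∀ k, 1 ≤ k → δ k < Δ k
  vv_eq : ∀ k, 1 ≤ k → vv k = ((2 : ℂ) ^ τ k)⁻¹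
  ww_eq : ∀ k, 1 ≤ k → ∀ i, 1 ≤ i → i < Δ k → ww k i = if i ≤ δ k then 2 else 1

/-- `T` is an operator of type `C_{+,1}` on `ℓ_p(ℤ_+)`. -/
def IsCPlusOneType {p : ℝ≥0∞} [Fact (1 ≤ p)]
    (T : lp (fun _ : ℕ => ℂ) p →L[ℂ] lp (fun _ : ℕ => ℂ) p) : Prop :=
  ∃ P : CPlusOneParams, P.toCTypeParams.IsOperator T

end LinDyn

/-! After rescaling the basis of block `n` to vectors `cell p n i`, the operator moves each cell to
the next one, and a full turn of length `len n.size` sends `cell p n 0` to `-cell p n 0 + gain n •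
cell p (parent n) 0`. A second turn cancels what was fed to the parent, so every finitely supported
vector is periodic. At stage `k` the cell norms grow from `1` to `2 ^ ramp k`, where `ramp k = len k
/ 8`, the gain is `2 ^ (ramp k - 8 * expo k)`, and the stages grow like a tower of exponentials.

Frequent hypercyclicity: copy a finitely supported `y` into child blocks of a late stage and divide
by the gain. This gives a tiny `z` with `T ^ len k z = y - z`, whose orbit stays small during a
fixed fraction of `len k`, because the gain is exponential in `len k` (`exists_hasToggles`). Adding
`z` to a periodic vector makes its orbit alternate between two prescribed orbits
(`HasToggles.exists_switch`). Iterating, with frequencies that do not depend on the number of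
targets, and passing to a limit gives a frequently hypercyclic vector
(`HasToggles.exists_frequently_visiting`).

Failure along `avoidingTimes`: call a coordinate of `x` active if it becomes huge when moved to the
flat part of its block. If `x` has active coordinates at arbitrarily late stages, take one at stage
`k`. It sits on the ramp, and at every avoiding time between `ramp k` and `len k ^ 2` it lies on the
flat part, where nothing else can cancel it. So at most `ramp k` of the avoiding times below `len k
^ 2` are visits to the unit ball, and the lower density is `0` (`lowerDensity_inter_le_zero`).
Otherwise, all but finitely many blocks feed summably little into coordinate `0`, which stays
bounded along the orbit (`exists_bound_of_not_isActive`). Neither case allows frequent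
hypercyclicity along `avoidingTimes`, which has positive lower density because its constraints at
different stages concern disjoint ranges of times. -/

namespace LinDyn

/-! ### Counting and lower density -/

/-- The number of elements of `S` below `N`. -/
noncomputable def countBelow (S : Set ℕ) (N : ℕ) : ℕ := (S ∩ Set.Iio N).ncard

theorem countBelow_mono {S S' : Set ℕ} (h : S ⊆ S') {N N' : ℕ} (hN : N ≤ N') :
    countBelow S N ≤ countBelow S' N' :=
  Set.ncard_le_ncard (Set.inter_subset_inter h (Set.Iio_subset_Iio hN))
    ((Set.finite_Iio N').subset Set.inter_subset_right)

theorem countBelow_le (S : Set ℕ) (N : ℕ) : countBelow S N ≤ N := by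
  have h := Set.ncard_le_ncard (Set.inter_subset_right (s := S) (t := Set.Iio N))
    (Set.finite_Iio N)
  have h2 : (Set.Iio N).ncard = N := by
    rw [← Finset.coe_Iio, Set.ncard_coe_finset, Nat.card_Iio]
  unfold countBelow
  omega

theorem card_le_countBelow {S : Set ℕ} {N : ℕ} {C : Finset ℕ}
    (h : ∀ c ∈ C, c ∈ S ∧ c < N) : C.card ≤ countBelow S N := by
  rw [← Set.ncard_coe_finset]
  exact Set.ncard_le_ncard (fun c hc => h c hc) ((Set.finite_Iio N).subset Set.inter_subset_right)

theorem exists_finset_countBelow (S : Set ℕ) (N : ℕ) :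
    ∃ C : Finset ℕ, C.card = countBelow S N ∧ ∀ c ∈ C, c ∈ S ∧ c < N := by
  have hf : (S ∩ Set.Iio N).Finite := (Set.finite_Iio N).subset Set.inter_subset_right
  refine ⟨hf.toFinset, (Set.ncard_eq_toFinset_card _ hf).symm, fun c hc => ?_⟩
  simpa using hc

theorem mul_card_le_countBelow {S : Set ℕ} {C : Finset ℕ} {P Q N : ℕ} (hC : ∀ c ∈ C, c < P)
    (hS : ∀ k < Q, ∀ c ∈ C, k * P + c ∈ S) (hN : Q * P ≤ N) :
    Q * C.card ≤ countBelow S N := by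
  have hinj : Set.InjOn (fun kc : ℕ × ℕ => kc.1 * P + kc.2) (Finset.range Q ×ˢ C : Finset _) := by
    rintro ⟨k, c⟩ h ⟨k', c'⟩ h' heq
    simp only [Finset.coe_product, Set.mem_prod, Finset.mem_coe, Finset.mem_range] at h h' heq
    have h1 := hC c h.2
    have h2 := hC c' h'.2
    have e1 : (k * P + c) / P = k := by
      rw [mul_comm, Nat.mul_add_div (by omega), Nat.div_eq_of_lt h1, add_zero]
    have e2 : (k' * P + c') / P = k' := by
      rw [mul_comm, Nat.mul_add_div (by omega), Nat.div_eq_of_lt h2, add_zero]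
    have hk : k = k' := by rw [← e1, ← e2, heq]
    subst hk
    simpa using heq
  have hcard := Finset.card_image_of_injOn hinj
  rw [Finset.card_product, Finset.card_range] at hcard
  rw [← hcard]
  refine card_le_countBelow fun m hm => ?_
  obtain ⟨⟨k, c⟩, hkc, rfl⟩ := Finset.mem_image.1 hm
  simp only [Finset.mem_product, Finset.mem_range] at hkc
  refine ⟨hS k hkc.1 c hkc.2, ?_⟩
  have h1 := hC c hkc.2
  have h2 : (k + 1) * P ≤ Q * P := Nat.mul_le_mul_right P hkc.1
  have h3 : (k + 1) * P = k * P + P := by ring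
  show k * P + c < N
  omega

/-- Only complete periods are counted; as `P ≤ N`, dropping the incomplete one costs at most a
factor `2`. -/
theorem le_countBelow_of_periodic {S : Set ℕ} {C : Finset ℕ} {P M N : ℕ} (hP : 0 < P)
    (hC : ∀ c ∈ C, c < P) (hS : ∀ k, ∀ c ∈ C, (k + 1) * P ≤ M → k * P + c ∈ S)
    (hPN : P ≤ N) (hNM : N ≤ M) :
    (C.card : ℝ) / (2 * P) * N ≤ countBelow S N := by
  have h1 : N / P * C.card ≤ countBelow S N := by
    refine mul_card_le_countBelow hC (fun k hk c hc => hS k c hc ?_) (Nat.div_mul_le_self N P)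
    calc (k + 1) * P ≤ N / P * P := Nat.mul_le_mul_right P hk
      _ ≤ N := Nat.div_mul_le_self N P
      _ ≤ M := hNM
  have h2 : N ≤ 2 * P * (N / P) := by
    have e1 : 1 ≤ N / P := (Nat.one_le_div_iff hP).2 hPN
    have e2 := Nat.div_add_mod N P
    have e3 := Nat.mod_lt N hP
    have e4 : P * 1 ≤ P * (N / P) := Nat.mul_le_mul_left P e1
    have e5 : 2 * P * (N / P) = P * (N / P) + P * (N / P) := by ring
    omega
  have h1' : ((N / P : ℕ) : ℝ) * C.card ≤ countBelow S N := by exact_mod_cast h1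
  have h2' : (N : ℝ) ≤ 2 * P * ((N / P : ℕ) : ℝ) := by exact_mod_cast h2
  have hP' : (0 : ℝ) < P := by exact_mod_cast hP
  refine le_trans ?_ h1'
  rw [div_mul_eq_mul_div, div_le_iff₀ (by positivity)]
  have hc : (0 : ℝ) ≤ C.card := by positivity
  nlinarith [mul_le_mul_of_nonneg_left h2' hc]

theorem lowerDensity_eq (S : Set ℕ) :
    lowerDensity S =
      Filter.liminf (fun N : ℕ => (countBelow S (N + 1) : ℝ) / ((N : ℝ) + 1)) Filter.atTop := by
  have h : ∀ N : ℕ, Set.Iic N = Set.Iio (N + 1) := fun N => by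
    ext m; simp
  simp only [lowerDensity, countBelow, h]

theorem countBelow_div_le (S : Set ℕ) (N : ℕ) : (countBelow S (N + 1) : ℝ) / ((N : ℝ) + 1) ≤ 1 := by
  rw [div_le_one (by positivity)]
  exact_mod_cast countBelow_le S (N + 1)

theorem le_lowerDensity {S : Set ℕ} {c : ℝ}
    (h : ∀ᶠ N : ℕ in Filter.atTop, c * N ≤ countBelow S N) : c ≤ lowerDensity S := by
  rw [lowerDensity_eq]
  refine Filter.le_liminf_of_le ?_ ?_
  · exact (Filter.isBoundedUnder_of ⟨1, countBelow_div_le S⟩).isCoboundedUnder_ge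
  · filter_upwards [(Filter.tendsto_add_atTop_nat 1).eventually h] with N hN
    rw [le_div_iff₀ (by positivity)]
    exact_mod_cast hN

theorem lowerDensity_le {S : Set ℕ} {c : ℝ}
    (h : ∃ᶠ N : ℕ in Filter.atTop, (countBelow S N : ℝ) ≤ c * N) : lowerDensity S ≤ c := by
  rw [lowerDensity_eq]
  have h' : ∃ᶠ N : ℕ in Filter.atTop, (countBelow S (N + 1) : ℝ) / ((N : ℝ) + 1) ≤ c := by
    rw [Filter.frequently_atTop] at h ⊢
    intro a
    obtain ⟨N, hN, hle⟩ := h (a + 1)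
    refine ⟨N - 1, by omega, ?_⟩
    obtain ⟨M, rfl⟩ : ∃ M, N = M + 1 := ⟨N - 1, by omega⟩
    rw [div_le_iff₀ (by positivity)]
    simpa using hle
  refine Filter.liminf_le_of_frequently_le h' ?_
  exact Filter.isBoundedUnder_of ⟨0, fun N => by positivity⟩

theorem lowerDensity_mono {S S' : Set ℕ} (h : S ⊆ S') : lowerDensity S ≤ lowerDensity S' := by
  rw [lowerDensity_eq, lowerDensity_eq]
  refine Filter.liminf_le_liminf (Filter.Eventually.of_forall fun N => ?_) ?_ ?_
  · have : countBelow S (N + 1) ≤ countBelow S' (N + 1) := countBelow_mono h le_rfl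
    gcongr
  · exact Filter.isBoundedUnder_of ⟨0, fun N => by positivity⟩
  · exact (Filter.isBoundedUnder_of ⟨1, countBelow_div_le S'⟩).isCoboundedUnder_ge

theorem lowerDensity_empty : lowerDensity ∅ ≤ 0 :=
  lowerDensity_le (Filter.Frequently.of_forall fun N => by simp [countBelow])

theorem nonempty_of_lowerDensity_pos {S : Set ℕ} (h : 0 < lowerDensity S) : S.Nonempty := by
  rw [Set.nonempty_iff_ne_empty]
  rintro rfl
  exact absurd h (not_lt.2 lowerDensity_empty)

/-! ### A criterion for frequent hypercyclicity -/

theorem exists_le_lt_succ {f : ℕ → ℕ} (hf : StrictMono f) {i₀ N : ℕ} (h : f i₀ ≤ N) :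
    ∃ i, i₀ ≤ i ∧ f i ≤ N ∧ N < f (i + 1) := by
  have hex : ∃ i, N < f (i + 1) := ⟨N, lt_of_lt_of_le (Nat.lt_succ_self N) (hf.id_le (N + 1))⟩
  classical
  have h1 := Nat.find_spec hex
  have h2 : i₀ ≤ Nat.find hex := by
    by_contra hlt
    have : f (Nat.find hex + 1) ≤ f i₀ := hf.monotone (by omega)
    omega
  refine ⟨Nat.find hex, h2, ?_, h1⟩
  by_contra hlt
  rcases Nat.eq_zero_or_pos (Nat.find hex) with h0 | h0
  · have : i₀ = 0 := by omega
    rw [h0] at hlt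
    subst this
    exact hlt h
  · have h3 := Nat.find_min hex (m := Nat.find hex - 1) (by omega)
    rw [Nat.sub_add_cancel h0] at h3
    omega

section Criterion

variable {X : Type*} [NormedAddCommGroup X] [NormedSpace ℂ X]

theorem iterate_add_apply (T : X →L[ℂ] X) (m n : ℕ) (x : X) :
    (T ^ (m + n)) x = (T ^ m) ((T ^ n) x) := by
  rw [pow_add]; rfl

theorem iterate_mul_of_periodic {T : X →L[ℂ] X} {P : ℕ} {x : X} (h : (T ^ P) x = x) (k : ℕ) :
    (T ^ (k * P)) x = x := by
  induction k with
  | zero => simp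
  | succ k ih => rw [Nat.succ_mul, iterate_add_apply, h, ih]

theorem iterate_of_dvd {T : X →L[ℂ] X} {P Q : ℕ} {x : X} (h : (T ^ P) x = x) (hd : P ∣ Q) :
    (T ^ Q) x = x := by
  obtain ⟨k, rfl⟩ := hd
  rw [mul_comm]
  exact iterate_mul_of_periodic h k

theorem iterate_mul_add_of_periodic {T : X →L[ℂ] X} {P : ℕ} {x : X} (h : (T ^ P) x = x)
    (k c : ℕ) : (T ^ (k * P + c)) x = (T ^ c) x := by
  rw [add_comm, iterate_add_apply, iterate_mul_of_periodic h]

/-- Every `y ∈ E` can be switched on after `q * H k` steps by a vector `z ∈ E` whose orbit stays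
small during the first `H k` steps. -/
def HasToggles (T : X →L[ℂ] X) (E : Submodule ℂ X) (q : ℕ) (H : ℕ → ℕ) : Prop :=
  ∀ y ∈ E, ∀ ε : ℝ, 0 < ε → ∀ᶠ k in Filter.atTop, (T ^ H k) y = y ∧
    ∃ z ∈ E, (T ^ (q * H k)) z = y - z ∧ ∀ m ≤ H k, ‖(T ^ m) z‖ ≤ ε

variable {T : X →L[ℂ] X} {E : Submodule ℂ X} {q : ℕ} {H : ℕ → ℕ}

/-- Take `u = a + z` with `z` a toggle for `b - a`. As `a` and `b` are fixed by `T ^ (q * H k)`,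
this power sends `a + z` to `b - z` and back. -/
theorem HasToggles.exists_switch (hT : HasToggles T E q H) {a b : X} (ha : a ∈ E) (hb : b ∈ E)
    {ε : ℝ} (hε : 0 < ε) :
    ∀ᶠ k in Filter.atTop, ∃ u ∈ E, (T ^ (2 * q * H k)) u = u ∧
      (∀ m ≤ H k, ‖(T ^ m) u - (T ^ m) a‖ ≤ ε) ∧
      ∀ m ≤ H k, ‖(T ^ (q * H k + m)) u - (T ^ m) b‖ ≤ ε := by
  filter_upwards [hT (b - a) (E.sub_mem hb ha) ε hε, hT a ha ε hε] with k hk hka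
  obtain ⟨hper, z, hz, hz1, hz2⟩ := hk
  have e1 : (T ^ (q * H k)) a = a := iterate_mul_of_periodic hka.1 q
  have e2 : (T ^ (q * H k)) (b - a) = b - a := iterate_mul_of_periodic hper q
  have e3 : (T ^ (q * H k)) b = b := by
    have : b = (b - a) + a := by abel
    rw [this, map_add, e1, e2]
  have e4 : (T ^ (q * H k)) (a + z) = b - z := by
    rw [map_add, e1, hz1]; abel
  refine ⟨a + z, E.add_mem ha hz, ?_, fun m hm => ?_, fun m hm => ?_⟩
  · rw [show 2 * q * H k = q * H k + q * H k by ring, iterate_add_apply, e4, map_sub, e3, hz1]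
    abel
  · rw [map_add, add_sub_cancel_left]
    exact hz2 m hm
  · rw [add_comm (q * H k), iterate_add_apply, e4, map_sub, sub_sub_cancel_left, norm_neg]
    exact hz2 m hm

theorem le_countBelow_of_window {u a y : X} {h o P : ℕ} {ε r r' d : ℝ} (hP : 0 < P)
    (hoP : o + h ≤ P) (hu : (T ^ P) u = u)
    (hclose : ∀ m ≤ h, ‖(T ^ (o + m)) u - (T ^ m) a‖ ≤ ε)
    (hr : r + ε ≤ r') (hcount : d * h ≤ countBelow (visitSet T a (Metric.ball y r)) h) {N : ℕ}
    (hN : P ≤ N) : d * h / (2 * P) * N ≤ countBelow (visitSet T u (Metric.ball y r')) N := by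
  obtain ⟨C, hC, hCmem⟩ := exists_finset_countBelow (visitSet T a (Metric.ball y r)) h
  have key := le_countBelow_of_periodic (S := visitSet T u (Metric.ball y r'))
    (C := C.map (addLeftEmbedding o)) (M := N) hP ?_ ?_ hN le_rfl
  · refine le_trans ?_ key
    rw [Finset.card_map, hC]
    gcongr
  · intro c hc
    obtain ⟨m, hm, rfl⟩ := Finset.mem_map.1 hc
    have := (hCmem m hm).2
    simp only [addLeftEmbedding_apply]
    omega
  · intro k c hc _
    obtain ⟨m, hm, rfl⟩ := Finset.mem_map.1 hc
    obtain ⟨h1, h2⟩ := hCmem m hm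
    simp only [addLeftEmbedding_apply]
    show (T ^ (k * P + (o + m))) u ∈ Metric.ball y r'
    rw [iterate_mul_add_of_periodic hu, mem_ball_iff_norm]
    have h3 : ‖(T ^ m) a - y‖ < r := mem_ball_iff_norm.1 h1
    have h4 := hclose m h2.le
    calc ‖(T ^ (o + m)) u - y‖ ≤ ‖(T ^ (o + m)) u - (T ^ m) a‖ + ‖(T ^ m) a - y‖ :=
          norm_sub_le_norm_sub_add_norm_sub _ _ _
      _ < r' := by linarith

/-- Switch between `x s` and a vector already serving the targets from `s + 1` on; hence the
induction leaves `s` free. Windows of length `H k` in a period `2 * q * H k`, with the factor `2`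
for incomplete periods, give `1 / (4 * q)` per switch. The frequency of the target `l` is thus
independent of `n`, which the passage to infinitely many targets requires. -/
theorem HasToggles.exists_multi (hT : HasToggles T E q H) (hq : 0 < q)
    (hH : Filter.Tendsto H Filter.atTop Filter.atTop) {x : ℕ → X} (hx : ∀ l, x l ∈ E)
    {κ : ℕ → ℝ} (hκ : ∀ l, ∀ r > 0, ∀ᶠ N : ℕ in Filter.atTop,
      κ l * N ≤ countBelow (visitSet T (x l) (Metric.ball (x l) r)) N) (n : ℕ) :
    ∀ s : ℕ, ∀ ε > 0, ∃ u ∈ E, ∀ l < n, ∀ᶠ N : ℕ in Filter.atTop,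
      (1 / (4 * q : ℝ)) ^ (l + 1) * κ (s + l) * N ≤
        countBelow (visitSet T u (Metric.ball (x (s + l)) ε)) N := by
  induction n with
  | zero => exact fun s ε _ => ⟨0, E.zero_mem, fun l hl => absurd hl (Nat.not_lt_zero l)⟩
  | succ n ih =>
    intro s ε hε
    obtain ⟨b, hb, hbfreq⟩ := ih (s + 1) (ε / 2) (half_pos hε)
    have hbfreq' : ∀ᶠ N : ℕ in Filter.atTop, ∀ l < n,
        (1 / (4 * q : ℝ)) ^ (l + 1) * κ (s + 1 + l) * N ≤
          countBelow (visitSet T b (Metric.ball (x (s + 1 + l)) (ε / 2))) N := by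
      have := (Filter.eventually_all_finset (l := Filter.atTop) (Finset.range n)
        (p := fun l (N : ℕ) => (1 / (4 * q : ℝ)) ^ (l + 1) * κ (s + 1 + l) * N ≤
          countBelow (visitSet T b (Metric.ball (x (s + 1 + l)) (ε / 2))) N)).2
        (fun l hl => hbfreq l (Finset.mem_range.1 hl))
      simpa using this
    obtain ⟨k, ⟨u, hu, hper, hua, hub⟩, hk1, hk2, hk3⟩ :=
      ((hT.exists_switch (hx s) hb (half_pos hε)).and
        ((hH.eventually hbfreq').and ((hH.eventually (hκ s (ε / 2) (half_pos hε))).and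
          (hH.eventually (Filter.eventually_ge_atTop 1))))).exists
    have hP : 0 < 2 * q * H k := by positivity
    have hle : H k ≤ q * H k := Nat.le_mul_of_pos_left _ hq
    have hconst : ∀ d : ℝ, d * (H k : ℝ) / (2 * ((2 * q * H k : ℕ) : ℝ)) = 1 / (4 * q) * d := by
      intro d
      have h1 : (H k : ℝ) ≠ 0 := by positivity
      have h2 : (q : ℝ) ≠ 0 := by positivity
      push_cast
      field_simp
      ring
    refine ⟨u, hu, fun l hl => ?_⟩
    filter_upwards [Filter.eventually_ge_atTop (2 * q * H k)] with N hN
    rcases l with _ | l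
    · have := le_countBelow_of_window (o := 0) (r' := ε) hP (by nlinarith) hper
        (by simpa using hua) (by linarith) hk2 hN
      rw [hconst] at this
      simpa using this
    · have := le_countBelow_of_window (o := q * H k) (r' := ε) hP (by nlinarith) hper hub
        (by linarith) (hk1 l (by omega)) hN
      rw [hconst] at this
      rw [show s + (l + 1) = s + 1 + l by ring]
      refine le_trans (le_of_eq ?_) this
      ring

/-- One more switch, from `s` to a vector serving the first `j` targets, explains the exponent `l +
2`. The new vector shadows `s` up to time `h` and has good visit counts from time `2 * q * h` on. -/
theorem HasToggles.exists_step (hT : HasToggles T E q H) (hq : 0 < q)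
    (hH : Filter.Tendsto H Filter.atTop Filter.atTop) {x : ℕ → X} (hx : ∀ l, x l ∈ E)
    {κ : ℕ → ℝ} (hκ : ∀ l, ∀ r > 0, ∀ᶠ N : ℕ in Filter.atTop,
      κ l * N ≤ countBelow (visitSet T (x l) (Metric.ball (x l) r)) N)
    (j : ℕ) (s : X) (hs : s ∈ E) (h₀ : ℕ) :
    ∃ s' ∈ E, ∃ h : ℕ, 2 * q * h₀ < h ∧
      (∀ m ≤ h, ‖(T ^ m) s' - (T ^ m) s‖ ≤ (1 / 2) ^ j) ∧
      ∀ l < j, ∀ N, 2 * q * h ≤ N →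
        (1 / (4 * q : ℝ)) ^ (l + 2) * κ l * N ≤
          countBelow (visitSet T s' (Metric.ball (x l) (2 * (1 / 2) ^ j))) N := by
  have hε : (0 : ℝ) < (1 / 2) ^ j := by positivity
  obtain ⟨b, hb, hbfreq⟩ := hT.exists_multi hq hH hx hκ j 0 _ hε
  have hbfreq' : ∀ᶠ N : ℕ in Filter.atTop, ∀ l < j,
      (1 / (4 * q : ℝ)) ^ (l + 1) * κ l * N ≤
        countBelow (visitSet T b (Metric.ball (x l) ((1 / 2) ^ j))) N := by
    have := (Filter.eventually_all_finset (l := Filter.atTop) (Finset.range j)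
      (p := fun l (N : ℕ) => (1 / (4 * q : ℝ)) ^ (l + 1) * κ (0 + l) * N ≤
        countBelow (visitSet T b (Metric.ball (x (0 + l)) ((1 / 2) ^ j))) N)).2
      (fun l hl => hbfreq l (Finset.mem_range.1 hl))
    simpa using this
  obtain ⟨k, ⟨u, hu, hper, hua, hub⟩, hk1, hk2⟩ :=
    ((hT.exists_switch hs hb hε).and
      ((hH.eventually hbfreq').and
        (hH.eventually (Filter.eventually_gt_atTop (2 * q * h₀))))).exists
  have hk3 : 0 < H k := by omega
  have hP : 0 < 2 * q * H k := by positivity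
  have hle : H k ≤ q * H k := Nat.le_mul_of_pos_left _ hq
  refine ⟨u, hu, H k, hk2, hua, fun l hl N hN => ?_⟩
  have := le_countBelow_of_window (o := q * H k) (r' := 2 * (1 / 2) ^ j) hP (by nlinarith) hper hub
    (by linarith) (hk1 l hl) hN
  refine le_trans (le_of_eq ?_) this
  have h1 : (H k : ℝ) ≠ 0 := by positivity
  have h2 : (q : ℝ) ≠ 0 := by positivity
  rw [show l + 2 = l + 1 + 1 by ring, pow_succ _ (l + 1)]
  generalize (1 / (4 * q : ℝ)) ^ (l + 1) = c
  push_cast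
  field_simp
  ring

theorem HasToggles.exists_frequently_visiting [CompleteSpace X] (hT : HasToggles T E q H)
    (hq : 0 < q) (hH : Filter.Tendsto H Filter.atTop Filter.atTop) {x : ℕ → X}
    (hx : ∀ l, x l ∈ E) {κ : ℕ → ℝ} (hκ₀ : ∀ l, 0 < κ l)
    (hκ : ∀ l, ∀ r > 0, ∀ᶠ N : ℕ in Filter.atTop,
      κ l * N ≤ countBelow (visitSet T (x l) (Metric.ball (x l) r)) N) :
    ∃ y : X, ∀ l, ∀ r > 0, 0 < lowerDensity (visitSet T y (Metric.ball (x l) r)) := by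
  choose! f hfE g hg hclose hcount using
    fun (j : ℕ) (s : X) (hs : s ∈ E) (h₀ : ℕ) => hT.exists_step hq hH hx hκ j s hs h₀
  let σ : ℕ → X × ℕ := fun n => Nat.rec (0, 0) (fun j p => (f j p.1 p.2, g j p.1 p.2)) n
  let s : ℕ → X := fun n => (σ n).1
  let h : ℕ → ℕ := fun n => (σ n).2
  have hsE : ∀ n, s n ∈ E := by
    intro n
    induction n with
    | zero => exact E.zero_mem
    | succ n ih => exact hfE n (s n) ih (h n)
  have hlt : ∀ j, 2 * q * h j < h (j + 1) := fun j => hg j (s j) (hsE j) (h j)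
  have hmono : StrictMono h := strictMono_nat_of_lt_succ fun j =>
    lt_of_le_of_lt (Nat.le_mul_of_pos_left _ (by positivity)) (hlt j)
  have hcl : ∀ j, ∀ m ≤ h (j + 1), ‖(T ^ m) (s (j + 1)) - (T ^ m) (s j)‖ ≤ (1 / 2) ^ j :=
    fun j => hclose j (s j) (hsE j) (h j)
  have hcnt : ∀ j, ∀ l < j, ∀ N, 2 * q * h (j + 1) ≤ N →
      (1 / (4 * q : ℝ)) ^ (l + 2) * κ l * N ≤
        countBelow (visitSet T (s (j + 1)) (Metric.ball (x l) (2 * (1 / 2) ^ j))) N :=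
    fun j => hcount j (s j) (hsE j) (h j)
  have hdist : ∀ i, dist (s i) (s (i + 1)) ≤ 1 * (1 / 2 : ℝ) ^ i := by
    intro i
    have := hcl i 0 (Nat.zero_le _)
    rw [dist_comm, dist_eq_norm, one_mul]
    simpa using this
  obtain ⟨y, hy⟩ := cauchySeq_tendsto_of_complete
    (cauchySeq_of_le_geometric (1 / 2 : ℝ) 1 (by norm_num) hdist)
  have hlim : ∀ j, ∀ m ≤ h (j + 1), ‖(T ^ m) (s j) - (T ^ m) y‖ ≤ 2 * (1 / 2) ^ j := by
    intro j m hm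
    have h1 : ∀ i, dist ((T ^ m) (s (i + j))) ((T ^ m) (s (i + 1 + j))) ≤
        (1 / 2 : ℝ) ^ j * (1 / 2 : ℝ) ^ i := by
      intro i
      rw [dist_comm, dist_eq_norm, ← pow_add, add_comm j i, show i + 1 + j = i + j + 1 by ring]
      exact hcl (i + j) m (hm.trans (hmono.monotone (show j + 1 ≤ i + j + 1 by omega)))
    have h2 : Filter.Tendsto (fun i => (T ^ m) (s (i + j))) Filter.atTop (nhds ((T ^ m) y)) :=
      ((T ^ m).continuous.tendsto y).comp (hy.comp (Filter.tendsto_add_atTop_nat j))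
    have h3 := dist_le_of_le_geometric_of_tendsto (1 / 2 : ℝ) _ (by norm_num) h1 h2 0
    rw [dist_eq_norm] at h3
    simp only [zero_add, pow_zero, mul_one] at h3
    exact h3.trans (le_of_eq (by ring))
  refine ⟨y, fun l r hr => ?_⟩
  obtain ⟨j₀, hj₀⟩ := exists_pow_lt_of_lt_one (show (0 : ℝ) < r / 3 by positivity)
    (show (1 / 2 : ℝ) < 1 by norm_num)
  set i₀ := max j₀ (l + 1) with hi₀
  set d : ℝ := (1 / (4 * q : ℝ)) ^ (l + 2) * κ l with hd
  have hq' : (0 : ℝ) < q := by exact_mod_cast hq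
  have hdpos : 0 < d := mul_pos (by positivity) (hκ₀ l)
  have hgood : ∀ i, i₀ ≤ i → ∀ N, 2 * q * h (i + 1) ≤ N → N ≤ h (i + 2) →
      d * N ≤ countBelow (visitSet T y (Metric.ball (x l) r)) N := by
    intro i hi N h1 h2
    refine (hcnt i l (by omega) N h1).trans ?_
    obtain ⟨C, hC, hCmem⟩ := exists_finset_countBelow
      (visitSet T (s (i + 1)) (Metric.ball (x l) (2 * (1 / 2) ^ i))) N
    rw [← hC]
    refine Nat.cast_le.2 (card_le_countBelow fun m hm => ⟨?_, (hCmem m hm).2⟩)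
    have h3 := hlim (i + 1) m ((hCmem m hm).2.le.trans h2)
    have h4 : ‖(T ^ m) (s (i + 1)) - x l‖ < 2 * (1 / 2) ^ i := mem_ball_iff_norm.1 (hCmem m hm).1
    have h5 : (1 / 2 : ℝ) ^ i ≤ (1 / 2) ^ j₀ :=
      pow_le_pow_of_le_one (by norm_num) (by norm_num) (by omega)
    show (T ^ m) y ∈ Metric.ball (x l) r
    rw [mem_ball_iff_norm]
    rw [pow_succ, norm_sub_rev] at h3
    linarith [norm_sub_le_norm_sub_add_norm_sub ((T ^ m) y) ((T ^ m) (s (i + 1))) (x l)]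
  refine lt_of_lt_of_le (show 0 < d / (2 * q) by positivity) (le_lowerDensity ?_)
  filter_upwards [Filter.eventually_ge_atTop (2 * q * h (i₀ + 1))] with N hN
  have hmono' : StrictMono fun i => 2 * q * h i := fun a b hab =>
    Nat.mul_lt_mul_of_pos_left (hmono hab) (by positivity)
  obtain ⟨i, hi, hi1, hi2⟩ := exists_le_lt_succ (i₀ := i₀ + 1) hmono' hN
  obtain ⟨i, rfl⟩ : ∃ i', i = i' + 1 := ⟨i - 1, by omega⟩
  have hq1 : (1 : ℝ) ≤ q := by exact_mod_cast hq
  rcases le_total N (h (i + 2)) with hle | hle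
  · refine le_trans ?_ (hgood i (by omega) N hi1 hle)
    refine mul_le_mul_of_nonneg_right (div_le_self hdpos.le (by linarith)) (by positivity)
  -- Between `h (i + 2)` and `2 * q * h (i + 2)` neither approximant controls the count; the visits
  -- before `h (i + 2)` suffice, at the cost of a factor `2 * q`.
  · have h1 := hgood i (by omega) (h (i + 2)) (hlt (i + 1)).le le_rfl
    have h2 : (countBelow (visitSet T y (Metric.ball (x l) r)) (h (i + 2)) : ℝ) ≤
        countBelow (visitSet T y (Metric.ball (x l) r)) N :=
      Nat.cast_le.2 (countBelow_mono subset_rfl hle)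
    have h3 : (N : ℝ) ≤ 2 * q * h (i + 2) := by exact_mod_cast hi2.le
    refine le_trans ?_ (h1.trans h2)
    rw [div_mul_eq_mul_div, div_le_iff₀ (by positivity)]
    nlinarith

theorem HasToggles.isFrequentlyHypercyclic [CompleteSpace X]
    [TopologicalSpace.SeparableSpace X] (hT : HasToggles T E q H) (hq : 0 < q)
    (hH : Filter.Tendsto H Filter.atTop Filter.atTop) (hE : Dense (E : Set X)) :
    IsFrequentlyHypercyclic T := by
  obtain ⟨t, htE, htc, htd⟩ := hE.exists_countable_dense_subset
  obtain ⟨x, rfl⟩ := htc.exists_eq_range htd.nonempty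
  have hxE : ∀ l, x l ∈ E := fun l => htE (Set.mem_range_self l)
  have hper : ∀ l, ∃ P, 0 < P ∧ (T ^ P) (x l) = x l := by
    intro l
    obtain ⟨k, hk1, hk2⟩ := ((hT (x l) (hxE l) 1 one_pos).and
      (hH.eventually (Filter.eventually_gt_atTop 0))).exists
    exact ⟨H k, hk2, hk1.1⟩
  choose P hP hPx using hper
  obtain ⟨y, hy⟩ := hT.exists_frequently_visiting hq hH hxE (κ := fun l => 1 / (2 * P l))
    (fun l => by have := hP l; positivity) (fun l r hr => by
      filter_upwards [Filter.eventually_ge_atTop (P l)] with N hN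
      have := le_countBelow_of_periodic (S := visitSet T (x l) (Metric.ball (x l) r)) (C := {0})
        (hP l) (by simpa using hP l) (fun k c hc _ => by
          rw [Finset.mem_singleton.1 hc]
          show (T ^ (k * P l + 0)) (x l) ∈ Metric.ball (x l) r
          rw [iterate_mul_add_of_periodic (hPx l)]
          simpa using hr) hN le_rfl
      simpa using this)
  refine ⟨y, fun V hV hne => ?_⟩
  obtain ⟨_, hxV, l, rfl⟩ := htd.inter_open_nonempty V hV hne
  obtain ⟨r, hr, hrV⟩ := Metric.isOpen_iff.1 hV _ hxV
  exact (hy l r hr).trans_le (lowerDensity_mono fun n hn => hrV hn)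

theorem HasToggles.dense_periodic (hT : HasToggles T E q H)
    (hH : Filter.Tendsto H Filter.atTop Filter.atTop) (hE : Dense (E : Set X)) :
    Dense {x : X | ∃ n : ℕ, 0 < n ∧ (T ^ n) x = x} := by
  refine hE.mono fun y hy => ?_
  obtain ⟨k, hk1, hk2⟩ := ((hT y hy 1 one_pos).and
    (hH.eventually (Filter.eventually_gt_atTop 0))).exists
  exact ⟨H k, hk2, hk1.1⟩

theorem IsFrequentlyHypercyclic.isHypercyclic (hT : IsFrequentlyHypercyclic T) :
    IsHypercyclic T := by
  obtain ⟨x, hx⟩ := hT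
  refine ⟨x, dense_iff_inter_open.2 fun V hV hne => ?_⟩
  obtain ⟨n, hn⟩ := nonempty_of_lowerDensity_pos (hx V hV hne)
  exact ⟨_, hn, n, rfl⟩

theorem IsHereditarilyFrequentlyHypercyclic.isFrequentlyHypercyclicAlong
    [TopologicalSpace.SeparableSpace X] (hT : IsHereditarilyFrequentlyHypercyclic T) {A : Set ℕ}
    (hA : 0 < lowerDensity A) : IsFrequentlyHypercyclicAlong T A := by
  obtain ⟨u, hu⟩ := TopologicalSpace.exists_dense_seq X
  obtain ⟨x, hx⟩ := hT (ℕ × ℕ) (fun i => Metric.ball (u i.1) (1 / (i.2 + 1))) (fun _ => A)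
    (fun _ => Metric.isOpen_ball) (fun i => Metric.nonempty_ball.2 (by positivity)) fun _ => hA
  refine ⟨x, fun V hV ⟨z, hz⟩ => ?_⟩
  obtain ⟨r, hr, hrV⟩ := Metric.isOpen_iff.1 hV z hz
  obtain ⟨n, hn⟩ := exists_nat_one_div_lt (half_pos hr)
  obtain ⟨l, hl⟩ := hu.exists_dist_lt z (show (0 : ℝ) < 1 / (n + 1) by positivity)
  refine (hx (l, n)).trans_le (lowerDensity_mono fun m hm => ⟨hm.2, hrV ?_⟩)
  have h1 : dist ((T ^ m) x) (u l) < 1 / (n + 1) := hm.1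
  rw [Metric.mem_ball]
  rw [dist_comm] at hl
  linarith [dist_triangle ((T ^ m) x) (u l) z]

end Criterion

/-! ### The parameters -/

/-- Binary logarithm of the block length at each stage. -/
def expo : ℕ → ℕ
  | 0 => 0
  | k + 1 => 2 ^ expo k + 16

/-- Length of the blocks of stage `k`. -/
def len (k : ℕ) : ℕ := 2 ^ expo k

/-- Number of weights equal to `2` in a block of stage `k`. -/
def ramp (k : ℕ) : ℕ := len k / 8

theorem expo_succ (k : ℕ) : expo (k + 1) = len k + 16 := rfl

theorem expo_strictMono : StrictMono expo := by
  refine strictMono_nat_of_lt_succ fun k => ?_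
  have := Nat.lt_two_pow_self (n := expo k)
  rw [expo_succ, len]
  omega

theorem le_expo (k : ℕ) : k ≤ expo k := expo_strictMono.id_le k

theorem le_expo_of_pos {k : ℕ} (hk : 1 ≤ k) : 17 ≤ expo k := by
  have h : expo 1 ≤ expo k := expo_strictMono.monotone hk
  have : expo 1 = 17 := rfl
  omega

theorem len_pos (k : ℕ) : 0 < len k := by unfold len; positivity

theorem len_strictMono : StrictMono len := fun _ _ h =>
  Nat.pow_lt_pow_right (by norm_num) (expo_strictMono h)

theorem ramp_mul {k : ℕ} (hk : 1 ≤ k) : ramp k * 8 = len k := by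
  have h := le_expo_of_pos hk
  refine Nat.div_mul_cancel ?_
  exact (pow_dvd_pow 2 (show 3 ≤ expo k by omega))

theorem ramp_lt (k : ℕ) : ramp k < len k := Nat.div_lt_self (len_pos k) (by norm_num)

/-- This keeps the exponent `ramp k - 8 * expo k` of the gain above `ramp k / 2`, hence proportional
to `len k`. -/
theorem mul_expo_le_ramp (k : ℕ) : 16 * expo k ≤ ramp k := by
  rcases Nat.eq_zero_or_pos k with rfl | hk
  · exact le_rfl
  · have h := le_expo_of_pos hk
    have h8 := ramp_mul hk
    suffices ∀ e, 17 ≤ e → 128 * e ≤ 2 ^ e by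
      have := this _ h
      rw [len] at h8
      omega
    intro e he
    induction e, he using Nat.le_induction with
    | base => norm_num
    | succ e he ih => rw [pow_succ]; omega

theorem two_mul_le_ramp (k : ℕ) : 2 * k ≤ ramp k := by
  have h1 := mul_expo_le_ramp k
  have h2 := le_expo k
  omega

theorem ramp_strictMono : StrictMono ramp := by
  refine strictMono_nat_of_lt_succ fun k => ?_
  have h1 := ramp_lt k
  have h2 := mul_expo_le_ramp (k + 1)
  rw [expo_succ] at h2
  omega

/-- Left end of the `n`-th block. -/
def blockStart (n : ℕ) : ℕ := ∑ i ∈ Finset.range n, len i.size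

theorem blockStart_succ (n : ℕ) : blockStart (n + 1) = blockStart n + len n.size :=
  Finset.sum_range_succ _ _

theorem blockStart_strictMono : StrictMono blockStart :=
  strictMono_nat_of_lt_succ fun n => by
    rw [blockStart_succ]
    have := len_pos n.size
    omega

/-- The block to which a coordinate belongs. -/
def blockOf (j : ℕ) : ℕ := Nat.findGreatest (fun n => blockStart n ≤ j) j

theorem blockOf_add {n i : ℕ} (hi : i < len n.size) : blockOf (blockStart n + i) = n := by
  have h1 : n ≤ blockStart n := blockStart_strictMono.id_le n
  rw [blockOf, Nat.findGreatest_eq_iff]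
  refine ⟨by omega, fun _ => Nat.le_add_right _ _, fun m hm _ hle => ?_⟩
  have h2 : blockStart (n + 1) ≤ blockStart m := blockStart_strictMono.monotone hm
  rw [blockStart_succ] at h2
  omega

theorem exists_eq_blockStart_add (j : ℕ) : ∃ n i, i < len n.size ∧ j = blockStart n + i := by
  obtain ⟨n, -, h1, h2⟩ := exists_le_lt_succ blockStart_strictMono
    (show blockStart 0 ≤ j from Nat.zero_le j)
  rw [blockStart_succ] at h2
  exact ⟨n, j - blockStart n, by omega, by omega⟩

/-- The weights. -/
def weight (j : ℕ) : ℂ :=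
  if 1 ≤ j - blockStart (blockOf j) ∧ j - blockStart (blockOf j) ≤ ramp (blockOf j).size
  then 2 else 1

theorem weight_add {n i : ℕ} (hi : i < len n.size) :
    weight (blockStart n + i) = if 1 ≤ i ∧ i ≤ ramp n.size then 2 else 1 := by
  rw [weight, blockOf_add hi, Nat.add_sub_cancel_left]

theorem weight_eq (j : ℕ) : weight j = 2 ∨ weight j = 1 := by
  unfold weight
  split_ifs <;> simp

/-- The parent of a block. -/
def parent (n : ℕ) : ℕ := n - 2 ^ (n.size - 1)

/-- The stage of block `n` is its number of binary digits, and `parent` erases the leading digit. -/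
theorem size_eq_of_mem {k n : ℕ} (hk : 1 ≤ k) (hn : n ∈ Set.Ico (2 ^ (k - 1)) (2 ^ k)) :
    n.size = k := by
  have h1 := Nat.size_le.2 hn.2
  have h2 := Nat.lt_size.2 hn.1
  omega

theorem parent_lt {n : ℕ} (hn : 1 ≤ n) : parent n < n :=
  Nat.sub_lt hn (by positivity)

theorem lt_two_pow_size (n : ℕ) : n < 2 ^ n.size := Nat.lt_size_self n

theorem size_pow_add {m l : ℕ} (h : l < 2 ^ m) : (2 ^ m + l).size = m + 1 :=
  size_eq_of_mem (by omega) ⟨by simp, by rw [pow_succ]; omega⟩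

theorem parent_pow_add {m l : ℕ} (h : l < 2 ^ m) : parent (2 ^ m + l) = l := by
  rw [parent, size_pow_add h]
  simp

theorem size_parent_lt {n : ℕ} (hn : 1 ≤ n) : (parent n).size < n.size := by
  have h0 : 0 < n.size := Nat.size_pos.2 hn
  have h1 := lt_two_pow_size n
  have h2 : (parent n).size ≤ n.size - 1 := by
    refine Nat.size_le.2 ?_
    have h3 : 2 ^ n.size = 2 ^ (n.size - 1) * 2 := by
      rw [← pow_succ, Nat.sub_add_cancel h0]
    have h4 : 0 < 2 ^ (n.size - 1) := by positivity
    unfold parent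
    omega
  omega

theorem prod_weight (n i : ℕ) (hi : i < len n.size) :
    ∏ j ∈ Finset.Ico (blockStart n + 1) (blockStart n + 1 + i), weight j =
      2 ^ min i (ramp n.size) := by
  induction i with
  | zero => simp
  | succ i ih =>
    rw [← add_assoc, Finset.prod_Ico_succ_top (by omega), ih (by omega), add_assoc, add_comm 1 i,
      weight_add hi]
    rcases lt_or_ge i (ramp n.size) with h | h
    · rw [if_pos ⟨by omega, by omega⟩, min_eq_left h.le, min_eq_left (by omega), pow_succ]
    · rw [if_neg (by omega), min_eq_right h, min_eq_right (by omega), mul_one]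

theorem Ioo_eq_Ico (n : ℕ) : Finset.Ioo (blockStart n) (blockStart (n + 1)) =
    Finset.Ico (blockStart n + 1) (blockStart n + 1 + (len n.size - 1)) := by
  have := len_pos n.size
  ext j
  rw [blockStart_succ]
  simp only [Finset.mem_Ioo, Finset.mem_Ico]
  omega

theorem blockProd_eq (n : ℕ) :
    ∏ j ∈ Finset.Ioo (blockStart n) (blockStart (n + 1)), weight j = 2 ^ ramp n.size := by
  have h1 := len_pos n.size
  have h2 := ramp_lt n.size
  rw [Ioo_eq_Ico, prod_weight n _ (by omega), min_eq_right (by omega)]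

theorem four_pow_inv_le (n : ℕ) : ((4 : ℝ) ^ n.size)⁻¹ ≤ 1 / ((n : ℝ) + 1) ^ 2 := by
  rw [inv_eq_one_div]
  refine one_div_le_one_div_of_le (by positivity) ?_
  have h : (n : ℝ) + 1 ≤ 2 ^ n.size := by exact_mod_cast lt_two_pow_size n
  calc ((n : ℝ) + 1) ^ 2 ≤ (2 ^ n.size) ^ 2 := by gcongr
    _ = 4 ^ n.size := by rw [← pow_mul, mul_comm, pow_mul]; norm_num

theorem summable_one_div_succ_sq : Summable fun n : ℕ => 1 / ((n : ℝ) + 1) ^ 2 := by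
  have := (summable_nat_add_iff 1).2 (Real.summable_one_div_nat_pow.2 (show 1 < 2 by norm_num))
  simpa using this

theorem summable_two_pow_inv {f : ℕ → ℕ} (hf : ∀ k, 2 * k ≤ f k) :
    Summable fun n : ℕ => ((2 : ℝ) ^ f n.size)⁻¹ := by
  refine Summable.of_nonneg_of_le (fun n => by positivity) (fun n => ?_) summable_one_div_succ_sq
  refine le_trans ?_ (four_pow_inv_le n)
  refine inv_anti₀ (by positivity) ?_
  calc (4 : ℝ) ^ n.size = 2 ^ (2 * n.size) := by rw [pow_mul]; norm_num
    _ ≤ 2 ^ f n.size := pow_le_pow_right₀ (by norm_num) (hf _)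

theorem two_mul_le_tau (k : ℕ) : 2 * k ≤ 8 * expo k := by
  have := le_expo k
  omega

/-- The parameters of the operator. -/
noncomputable def params : CPlusOneParams where
  v n := ((2 : ℂ) ^ (8 * expo n.size))⁻¹
  w := weight
  φ := parent
  b := blockStart
  v_ne_zero n _ := inv_ne_zero (pow_ne_zero _ two_ne_zero)
  v_summable := by
    have := (summable_nat_add_iff 1).2 (summable_two_pow_inv two_mul_le_tau)
    simpa using this
  w_bounded_below := ⟨1, one_pos, fun j _ => by rcases weight_eq j with h | h <;> simp [h]⟩
  w_bounded_above := ⟨2, fun j _ => by rcases weight_eq j with h | h <;> simp [h]⟩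
  φ_zero := rfl
  φ_lt n hn := parent_lt hn
  φ_fiber_infinite l := by
    refine Set.infinite_of_injective_forall_mem (f := fun m => 2 ^ (l + m) + l) ?_ fun m => ?_
    · intro m m' h
      have h' : 2 ^ (l + m) = 2 ^ (l + m') := Nat.add_right_cancel h
      have := Nat.pow_right_injective le_rfl h'
      omega
    · exact parent_pow_add ((Nat.lt_two_pow_self (n := l)).trans_le
        (Nat.pow_le_pow_right (by norm_num) (by omega)))
  b_zero := rfl
  b_strictMono := blockStart_strictMono
  b_dvd n hn := by
    rw [blockStart_succ, blockStart_succ, Nat.add_sub_cancel_left, Nat.add_sub_cancel_left,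
      len, len, ← pow_succ']
    exact pow_dvd_pow 2 (expo_strictMono (size_parent_lt hn))
  prod_bounded_below := by
    refine ⟨1, one_pos, fun n => ?_⟩
    rw [← norm_prod, blockProd_eq, norm_pow, Complex.norm_ofNat]
    exact one_le_pow₀ one_le_two
  Δ := len
  vv k := ((2 : ℂ) ^ (8 * expo k))⁻¹
  ww k i := if i ≤ ramp k then 2 else 1
  φ_eq k hk n hn := by rw [parent, size_eq_of_mem hk hn]
  block_size k hk n hn := by
    rw [blockStart_succ, Nat.add_sub_cancel_left, size_eq_of_mem hk hn]
  v_eq k hk n hn := by rw [size_eq_of_mem hk hn]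
  w_eq k hk n hn i hi hi' := by
    rw [weight_add (by rwa [size_eq_of_mem hk hn]), size_eq_of_mem hk hn]
    simp [hi]
  τ k := 8 * expo k
  δ := ramp
  τ_strictMono := fun i _ j _ h => by
    have := expo_strictMono h
    show 8 * expo i < 8 * expo j
    omega
  δ_strictMono := ramp_strictMono.strictMonoOn _
  δ_lt k _ := ramp_lt k
  vv_eq _ _ := rfl
  ww_eq _ _ _ _ _ := rfl

theorem params_blockProd (n : ℕ) : params.blockProd n = 2 ^ ramp n.size := blockProd_eq n

/-! ### Existence of the operator -/

section Existence

variable {p : ℝ≥0∞} [Fact (1 ≤ p)]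

theorem toReal_pos_of_ne_top (hp : p ≠ ∞) : 0 < p.toReal :=
  ENNReal.toReal_pos (zero_lt_one.trans_le (Fact.out : 1 ≤ p)).ne' hp

/-- The weighted forward shift `(x_0, x_1, …) ↦ (0, a_0 x_0, a_1 x_1, …)`. -/
def shiftFun (a x : ℕ → ℂ) : ℕ → ℂ
  | 0 => 0
  | j + 1 => a j * x j

theorem hasSum_shiftFun_le (hp : p ≠ ∞) {a : ℕ → ℂ} {C : ℝ} (ha : ∀ j, ‖a j‖ ≤ C)
    (x : lp (fun _ : ℕ => ℂ) p) :
    Summable (fun j => ‖shiftFun a x j‖ ^ p.toReal) ∧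
      ∑' j, ‖shiftFun a x j‖ ^ p.toReal ≤ (C * ‖x‖) ^ p.toReal := by
  have hp' := toReal_pos_of_ne_top hp
  have hC : 0 ≤ C := (norm_nonneg _).trans (ha 0)
  have hsum := (lp.hasSum_norm hp' x).mul_left (C ^ p.toReal)
  have hle : ∀ j, ‖shiftFun a x (j + 1)‖ ^ p.toReal ≤ C ^ p.toReal * ‖x j‖ ^ p.toReal := by
    intro j
    rw [shiftFun, norm_mul, ← Real.mul_rpow hC (norm_nonneg _)]
    gcongr
    exact ha j
  have hs1 : Summable fun j => ‖shiftFun a x (j + 1)‖ ^ p.toReal :=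
    Summable.of_nonneg_of_le (fun j => by positivity) hle hsum.summable
  have hs : Summable fun j => ‖shiftFun a x j‖ ^ p.toReal := (summable_nat_add_iff 1).1 hs1
  refine ⟨hs, ?_⟩
  rw [hs.tsum_eq_zero_add, shiftFun, norm_zero, Real.zero_rpow hp'.ne', zero_add,
    Real.mul_rpow hC (norm_nonneg _), ← hsum.tsum_eq]
  exact hs1.tsum_le_tsum hle hsum.summable

/-- The weighted forward shift as an operator on `ℓ_p`. -/
noncomputable def weightedShift (hp : p ≠ ∞) (a : ℕ → ℂ) (C : ℝ) (ha : ∀ j, ‖a j‖ ≤ C) :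
    lp (fun _ : ℕ => ℂ) p →L[ℂ] lp (fun _ : ℕ => ℂ) p :=
  LinearMap.mkContinuous
    { toFun := fun x => ⟨shiftFun a x, memℓp_gen (hasSum_shiftFun_le hp ha x).1⟩
      map_add' := fun x y => by
        refine lp.ext (funext fun j => ?_)
        cases j with
        | zero => exact (add_zero (0 : ℂ)).symm
        | succ j => exact mul_add (a j) (x j) (y j)
      map_smul' := fun c x => by
        refine lp.ext (funext fun j => ?_)
        cases j with
        | zero => exact (mul_zero c).symm
        | succ j => exact mul_left_comm (a j) c (x j) } C
    (fun x => lp.norm_le_of_tsum_le (toReal_pos_of_ne_top hp)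
      (mul_nonneg ((norm_nonneg _).trans (ha 0)) (norm_nonneg _))
      (hasSum_shiftFun_le hp ha x).2)

theorem weightedShift_apply (hp : p ≠ ∞) (a : ℕ → ℂ) (C : ℝ) (ha : ∀ j, ‖a j‖ ≤ C)
    (x : lp (fun _ : ℕ => ℂ) p) (j : ℕ) : weightedShift hp a C ha x j = shiftFun a x j := rfl

theorem weightedShift_single (hp : p ≠ ∞) (a : ℕ → ℂ) (C : ℝ) (ha : ∀ j, ‖a j‖ ≤ C) (k : ℕ) :
    weightedShift hp a C ha (lp.single p k (1 : ℂ)) = a k • lp.single p (k + 1) (1 : ℂ) := by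
  refine lp.ext (funext fun j => ?_)
  rw [weightedShift_apply]
  cases j with
  | zero => simp [shiftFun]
  | succ j =>
    rw [shiftFun, lp.coeFn_smul, Pi.smul_apply, lp.single_apply, lp.single_apply, Pi.single_apply,
      Pi.single_apply, smul_eq_mul]
    by_cases h : j = k
    · simp [h]
    · simp [h]

/-- An absolutely summable series of rank one operators reading distinct coordinates. -/
theorem exists_operator_of_summable (f : ℕ → ℕ) (hf : Function.Injective f)
    (u : ℕ → lp (fun _ : ℕ => ℂ) p) (hu : Summable fun n => ‖u n‖) :
    ∃ R : lp (fun _ : ℕ => ℂ) p →L[ℂ] lp (fun _ : ℕ => ℂ) p,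
      (∀ n, R (lp.single p (f n) (1 : ℂ)) = u n) ∧
      ∀ k, (∀ n, f n ≠ k) → R (lp.single p k (1 : ℂ)) = 0 := by
  let r : ℕ → lp (fun _ : ℕ => ℂ) p →L[ℂ] lp (fun _ : ℕ => ℂ) p :=
    fun n => (lp.evalCLM ℂ (fun _ : ℕ => ℂ) p (f n)).smulRight (u n)
  have hr : ∀ n x, r n x = x (f n) • u n := fun n x => rfl
  have hsum : Summable r := by
    refine Summable.of_norm_bounded hu fun n => ?_
    refine ContinuousLinearMap.opNorm_le_bound _ (norm_nonneg _) fun x => ?_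
    rw [hr, norm_smul, mul_comm]
    gcongr
    exact lp.norm_apply_le_norm (zero_lt_one.trans_le (Fact.out : 1 ≤ p)).ne' x (f n)
  have happ : ∀ x, HasSum (fun n => x (f n) • u n) ((∑' n, r n) x) := fun x =>
    hsum.hasSum.mapL (ContinuousLinearMap.apply ℂ (lp (fun _ : ℕ => ℂ) p) x)
  refine ⟨∑' n, r n, fun n => ?_, fun k hk => ?_⟩
  · refine (happ _).unique ?_
    have := hasSum_single (f := fun m => (lp.single p (f n) (1 : ℂ) : ℕ → ℂ) (f m) • u m) n
      (fun m hm => by rw [lp.single_apply_ne _ _ _ (fun h => hm (hf h)), zero_smul])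
    rwa [lp.single_apply_self, one_smul] at this
  · refine (happ _).unique ?_
    convert (hasSum_zero : HasSum (fun _ : ℕ => (0 : lp (fun _ : ℕ => ℂ) p)) 0) using 2 with m
    rw [lp.single_apply_ne _ _ _ (hk m), zero_smul]

theorem norm_single_one (k : ℕ) : ‖lp.single (E := fun _ : ℕ => ℂ) p k (1 : ℂ)‖ = 1 := by
  rw [lp.norm_single (zero_lt_one.trans_le (Fact.out : 1 ≤ p)), norm_one]

/-- The image of the last basis vector of the `n`-th block. -/
noncomputable def lastImage (p : ℝ≥0∞) (n : ℕ) : lp (fun _ : ℕ => ℂ) p :=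
  (if n = 0 then 0 else ((2 : ℂ) ^ (8 * expo n.size))⁻¹) •
      lp.single p (blockStart (parent n)) (1 : ℂ)
    - ((2 : ℂ) ^ ramp n.size)⁻¹ • lp.single p (blockStart n) (1 : ℂ)

theorem summable_norm_lastImage : Summable fun n => ‖lastImage p n‖ := by
  refine Summable.of_nonneg_of_le (fun n => norm_nonneg _) (fun n => ?_)
    ((summable_two_pow_inv two_mul_le_tau).add (summable_two_pow_inv two_mul_le_ramp))
  refine (norm_sub_le _ _).trans (add_le_add ?_ ?_)
  · rw [norm_smul, norm_single_one, mul_one]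
    split_ifs
    · rw [norm_zero]; positivity
    · simp
  · rw [norm_smul, norm_single_one, mul_one]
    simp

/-- A bounded weighted shift whose weights vanish at block ends, plus an absolutely convergent
series of rank one operators acting on the last basis vectors of the blocks. -/
theorem exists_isOperator (hp : p ≠ ∞) :
    ∃ T : lp (fun _ : ℕ => ℂ) p →L[ℂ] lp (fun _ : ℕ => ℂ) p, params.IsOperator T := by
  classical
  have hlast : ∀ n, blockStart (n + 1) - 1 + 1 = blockStart (n + 1) := fun n =>
    Nat.sub_add_cancel (blockStart_strictMono (Nat.succ_pos n))
  obtain ⟨R, hR1, hR2⟩ := exists_operator_of_summable (p := p) (fun n => blockStart (n + 1) - 1)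
    (fun m n h => by
      have h' : blockStart (m + 1) = blockStart (n + 1) := by
        rw [← hlast m, ← hlast n]; exact congrArg (· + 1) h
      have := blockStart_strictMono.injective h'
      omega) (lastImage p) summable_norm_lastImage
  have ha : ∀ j, ‖if ∃ n, j + 1 = blockStart n then (0 : ℂ) else weight (j + 1)‖ ≤ 2 := by
    intro j
    split_ifs
    · simp
    · rcases weight_eq (j + 1) with h | h <;> simp [h]
  have hend : ∀ n k : ℕ, k + 1 = blockStart (n + 1) →
      (weightedShift hp _ 2 ha + R) (lp.single p k (1 : ℂ)) = lastImage p n := by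
    intro n k hk
    have hk' : k = blockStart (n + 1) - 1 := by omega
    rw [add_apply, weightedShift_single, if_pos ⟨n + 1, hk⟩, zero_smul,
      zero_add, hk', hR1]
  refine ⟨weightedShift hp _ 2 ha + R, fun n k h1 h2 => ?_, fun n k hn hk => ?_, fun k hk => ?_⟩
  · have hne : ∀ m, k + 1 ≠ blockStart m := by
      intro m hm
      have h3 : blockStart n < blockStart m := by
        rw [← hm]; exact Nat.lt_succ_of_le h1
      have h4 : blockStart m < blockStart (n + 1) := by rw [← hm]; exact h2
      rw [blockStart_strictMono.lt_iff_lt] at h3 h4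
      omega
    rw [add_apply, weightedShift_single, if_neg (by simpa using hne), hR2,
      add_zero]
    · rfl
    · intro m hm
      exact hne (m + 1) (by rw [← hlast m, ← hm])
  · rw [hend n k hk, lastImage, if_neg (by omega), params_blockProd]
    rfl
  · rw [hend 0 k hk, lastImage, if_pos rfl, params_blockProd, zero_smul, zero_sub]
    rfl

end Existence

/-! ### Orbits of the basis vectors -/

section Orbits

/-- The normalized basis vectors: `T` maps each to the next one inside a block. -/
noncomputable def cell (p : ℝ≥0∞) (n i : ℕ) : lp (fun _ : ℕ => ℂ) p :=
  (2 : ℂ) ^ min i (ramp n.size) • lp.single p (blockStart n + i) (1 : ℂ)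

theorem single_eq_smul_cell {p : ℝ≥0∞} (n i : ℕ) : lp.single p (blockStart n + i) (1 : ℂ) =
    ((2 : ℂ) ^ min i (ramp n.size))⁻¹ • cell p n i := by
  rw [cell, smul_smul, inv_mul_cancel₀ (pow_ne_zero _ two_ne_zero), one_smul]

theorem cell_apply_self {p : ℝ≥0∞} (n i : ℕ) : cell p n i (blockStart n + i) = 2 ^ min i (ramp n.size) := by
  rw [cell, lp.coeFn_smul, Pi.smul_apply, lp.single_apply_self, smul_eq_mul, mul_one]

theorem cell_apply_ne {p : ℝ≥0∞} (n i : ℕ) {j : ℕ} (h : j ≠ blockStart n + i) : cell p n i j = 0 := by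
  rw [cell, lp.coeFn_smul, Pi.smul_apply, lp.single_apply_ne _ _ _ h, smul_zero]

/-- The factor with which a block feeds its parent. -/
noncomputable def gain (n : ℕ) : ℂ :=
  if n = 0 then 0 else 2 ^ ramp n.size * (2 ^ (8 * expo n.size))⁻¹

variable {p : ℝ≥0∞} [Fact (1 ≤ p)]

theorem norm_cell (n i : ℕ) : ‖cell p n i‖ = 2 ^ min i (ramp n.size) := by
  rw [cell, norm_smul, norm_single_one, mul_one, norm_pow, Complex.norm_ofNat]

theorem gain_eq {n : ℕ} (hn : 1 ≤ n) : gain n = 2 ^ (ramp n.size - 8 * expo n.size) := by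
  have h := mul_expo_le_ramp n.size
  rw [gain, if_neg (by omega), ← div_eq_mul_inv, div_eq_iff (pow_ne_zero _ two_ne_zero), ← pow_add,
    Nat.sub_add_cancel (by omega)]

theorem norm_gain_le (n : ℕ) : ‖gain n‖ ≤ 2 ^ (ramp n.size - 8 * expo n.size) := by
  rcases Nat.eq_zero_or_pos n with rfl | hn
  · rw [gain, if_pos rfl, norm_zero]; positivity
  · rw [gain_eq hn, norm_pow, Complex.norm_ofNat]

variable {T : lp (fun _ : ℕ => ℂ) p →L[ℂ] lp (fun _ : ℕ => ℂ) p}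

theorem map_cell (hT : params.IsOperator T) {n i : ℕ} (hi : i + 1 < len n.size) :
    T (cell p n i) = cell p n (i + 1) := by
  have h1 := hT.inside n (blockStart n + i) (Nat.le_add_right _ _) (by
    show _ < blockStart (n + 1)
    rw [blockStart_succ]; omega)
  rw [cell, map_smul, h1, cell, smul_smul, ← add_assoc]
  congr 1
  show _ * weight (blockStart n + (i + 1)) = _
  rw [weight_add hi]
  rcases lt_or_ge i (ramp n.size) with h | h
  · rw [if_pos ⟨by omega, by omega⟩, min_eq_left h.le, min_eq_left (by omega), pow_succ]
  · rw [if_neg (by omega), min_eq_right h, min_eq_right (by omega), mul_one]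

theorem map_cell_last (hT : params.IsOperator T) {n i : ℕ} (hi : i + 1 = len n.size) :
    T (cell p n i) = -cell p n 0 + gain n • cell p (parent n) 0 := by
  have hr := ramp_lt n.size
  have h2 : (2 : ℂ) ^ ramp n.size ≠ 0 := pow_ne_zero _ two_ne_zero
  have hk : blockStart n + i + 1 = blockStart (n + 1) := by rw [blockStart_succ]; omega
  simp only [cell, map_smul, Nat.zero_min, pow_zero, one_smul, add_zero]
  rw [min_eq_right (by omega)]
  rcases Nat.eq_zero_or_pos n with rfl | hn
  · rw [hT.last_zero _ hk, params_blockProd, gain, if_pos rfl, zero_smul, add_zero, smul_neg,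
      smul_smul, mul_inv_cancel₀ h2, one_smul]
    rfl
  · rw [hT.last n _ hn hk, params_blockProd, smul_sub, smul_smul, smul_smul, mul_inv_cancel₀ h2,
      one_smul, gain, if_neg (by omega), neg_add_eq_sub]
    rfl

theorem iterate_cell_zero (hT : params.IsOperator T) {n i : ℕ} (hi : i < len n.size) :
    (T ^ i) (cell p n 0) = cell p n i := by
  induction i with
  | zero => rfl
  | succ i ih => rw [add_comm i 1, iterate_add_apply, ih (by omega), pow_one, add_comm 1 i,
      map_cell hT hi]

theorem iterate_len_cell_zero (hT : params.IsOperator T) (n : ℕ) :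
    (T ^ len n.size) (cell p n 0) = -cell p n 0 + gain n • cell p (parent n) 0 := by
  have h := len_pos n.size
  obtain ⟨i, hi⟩ : ∃ i, i + 1 = len n.size := ⟨len n.size - 1, by omega⟩
  rw [← hi, add_comm, iterate_add_apply, iterate_cell_zero hT (by omega), pow_one,
    map_cell_last hT hi]

/-- The parent cell is fixed by `T ^ len n.size`, since twice the parent length divides `len
n.size`; so the parts fed in the two turns cancel because of the sign `-1`. -/
theorem iterate_two_mul_len_cell (hT : params.IsOperator T) (n : ℕ) :
    (T ^ (2 * len n.size)) (cell p n 0) = cell p n 0 := by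
  induction n using Nat.strong_induction_on with
  | _ n ih =>
    rw [two_mul, iterate_add_apply, iterate_len_cell_zero hT, map_add, map_neg,
      iterate_len_cell_zero hT, map_smul]
    rcases Nat.eq_zero_or_pos n with rfl | hn
    · simp [gain]
    · have hd : 2 * len (parent n).size ∣ len n.size := by
        rw [len, len, ← pow_succ']
        exact pow_dvd_pow 2 (expo_strictMono (size_parent_lt hn))
      rw [iterate_of_dvd (ih _ (parent_lt hn)) hd]
      abel

theorem iterate_two_pow_cell (hT : params.IsOperator T) {n i e : ℕ} (hi : i < len n.size)
    (he : expo n.size < e) : (T ^ 2 ^ e) (cell p n i) = cell p n i := by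
  rw [← iterate_cell_zero hT hi, ← iterate_add_apply, add_comm, iterate_add_apply,
    iterate_of_dvd (iterate_two_mul_len_cell hT n)]
  rw [len, ← pow_succ']
  exact pow_dvd_pow 2 he

theorem iterate_len_cell (hT : params.IsOperator T) {n i : ℕ} (hi : i < len n.size) :
    (T ^ len n.size) (cell p n i) = -cell p n i + gain n • (T ^ i) (cell p (parent n) 0) := by
  rw [← iterate_cell_zero hT hi, ← iterate_add_apply, add_comm, iterate_add_apply,
    iterate_len_cell_zero hT, map_add, map_neg, map_smul]

/-- The orbit of a normalized basis vector: it rotates inside its block up to a sign, and carries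
a part fed to the parent block during every other turn. -/
theorem iterate_cell (hT : params.IsOperator T) {n i : ℕ} (hi : i < len n.size) (m : ℕ) :
    ∃ s t : ℂ, ‖s‖ = 1 ∧ ‖t‖ ≤ 1 ∧ (i + m < len n.size → t = 0) ∧
      (T ^ m) (cell p n i) = s • cell p n ((i + m) % len n.size) +
        (t * gain n) • (T ^ ((i + m) % len n.size)) (cell p (parent n) 0) := by
  have hr : (i + m) % len n.size < len n.size := Nat.mod_lt _ (len_pos _)
  have h0 : (T ^ m) (cell p n i) = (T ^ ((i + m) / len n.size * len n.size))
      ((T ^ ((i + m) % len n.size)) (cell p n 0)) := by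
    rw [← iterate_add_apply, mul_comm, Nat.div_add_mod, ← iterate_cell_zero hT hi,
      ← iterate_add_apply, add_comm]
  rw [h0, iterate_cell_zero hT hr]
  have hper : (T ^ (2 * len n.size)) (cell p n ((i + m) % len n.size)) =
      cell p n ((i + m) % len n.size) := by
    rw [len, ← pow_succ']
    exact iterate_two_pow_cell hT hr (Nat.lt_succ_self _)
  rcases Nat.even_or_odd' ((i + m) / len n.size) with ⟨c, hc | hc⟩
  · refine ⟨1, 0, norm_one, by simp, fun _ => rfl, ?_⟩
    rw [hc, mul_comm 2 c, mul_assoc, iterate_mul_of_periodic hper]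
    simp
  · refine ⟨-1, 1, by simp, by simp, fun h => ?_, ?_⟩
    · rw [Nat.div_eq_of_lt h] at hc
      omega
    · rw [hc, show (2 * c + 1) * len n.size = c * (2 * len n.size) + len n.size by ring,
        iterate_mul_add_of_periodic hper, iterate_len_cell hT hr]
      simp

/-- The part in the block is at most `2 ^ ramp n.size`, and the fed part at most that times the
bound for the parent, whose length is well below `ramp n.size`. -/
theorem norm_iterate_cell_zero_le (hT : params.IsOperator T) (n m : ℕ) :
    ‖(T ^ m) (cell p n 0)‖ ≤ 2 ^ len n.size := by
  induction n using Nat.strong_induction_on generalizing m with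
  | _ n ih =>
    obtain ⟨s, t, hs, ht, -, h⟩ := iterate_cell hT (len_pos n.size) m
    rw [h]
    have h1 : ‖s • cell p n ((0 + m) % len n.size)‖ ≤ 2 ^ ramp n.size := by
      rw [norm_smul, hs, one_mul, norm_cell]
      exact pow_le_pow_right₀ one_le_two (min_le_right _ _)
    rcases Nat.eq_zero_or_pos n with rfl | hn
    · rw [gain, if_pos rfl, mul_zero, zero_smul, add_zero]
      exact h1.trans (pow_le_pow_right₀ one_le_two (ramp_lt _).le)
    · have h2 := ih _ (parent_lt hn) ((0 + m) % len n.size)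
      have hsz : 1 ≤ n.size := Nat.size_pos.2 hn
      have h3 : len (parent n).size + 1 ≤ ramp n.size := by
        have h4 := mul_expo_le_ramp n.size
        have h5 : len (parent n).size ≤ len (n.size - 1) :=
          len_strictMono.monotone (by have := size_parent_lt hn; omega)
        obtain ⟨k, hk⟩ : ∃ k, n.size = k + 1 := ⟨n.size - 1, by omega⟩
        rw [hk] at h4 h5 ⊢
        rw [expo_succ] at h4
        rw [Nat.add_sub_cancel] at h5
        omega
      have h4 : ‖(t * gain n) • (T ^ ((0 + m) % len n.size)) (cell p (parent n) 0)‖ ≤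
          2 ^ ramp n.size * 2 ^ len (parent n).size := by
        rw [norm_smul, norm_mul]
        refine mul_le_mul ?_ h2 (norm_nonneg _) (by positivity)
        calc ‖t‖ * ‖gain n‖ ≤ 1 * 2 ^ (ramp n.size - 8 * expo n.size) :=
              mul_le_mul ht (norm_gain_le n) (norm_nonneg _) zero_le_one
          _ ≤ 2 ^ ramp n.size := by
              rw [one_mul]; exact pow_le_pow_right₀ one_le_two (Nat.sub_le _ _)
      have h6 : (2 : ℝ) ^ ramp n.size ≤ 2 ^ ramp n.size * 2 ^ len (parent n).size :=
        le_mul_of_one_le_right (by positivity) (one_le_pow₀ one_le_two)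
      calc _ ≤ 2 ^ ramp n.size * 2 ^ len (parent n).size +
            2 ^ ramp n.size * 2 ^ len (parent n).size :=
            (norm_add_le _ _).trans (add_le_add (h1.trans h6) h4)
        _ = (2 : ℝ) ^ (ramp n.size + (len (parent n).size + 1)) := by
            rw [pow_add, pow_succ]; ring
        _ ≤ 2 ^ len n.size := by
            refine pow_le_pow_right₀ one_le_two ?_
            have := ramp_mul hsz
            omega

theorem iterate_cell_zero_apply_eq_zero (hT : params.IsOperator T) {n j : ℕ}
    (hj : blockStart (n + 1) ≤ j) (m : ℕ) : (T ^ m) (cell p n 0) j = 0 := by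
  induction n using Nat.strong_induction_on generalizing m with
  | _ n ih =>
    obtain ⟨s, t, -, -, -, h⟩ := iterate_cell hT (len_pos n.size) m
    have hr : (0 + m) % len n.size < len n.size := Nat.mod_lt _ (len_pos _)
    have h1 := hj
    rw [blockStart_succ] at h1
    rw [h, lp.coeFn_add, Pi.add_apply, lp.coeFn_smul, Pi.smul_apply, lp.coeFn_smul, Pi.smul_apply,
      cell_apply_ne _ _ (by omega), smul_zero, zero_add]
    rcases Nat.eq_zero_or_pos n with rfl | hn
    · rw [gain, if_pos rfl, mul_zero, zero_smul]
    · rw [ih _ (parent_lt hn), smul_zero]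
      have := blockStart_strictMono.monotone (show parent n + 1 ≤ n + 1 by
        have := parent_lt hn; omega)
      omega

end Orbits

/-! ### Frequent hypercyclicity -/

section Positive

variable {p : ℝ≥0∞} [Fact (1 ≤ p)]

/-- The finitely supported sequences. -/
noncomputable def finSupp (p : ℝ≥0∞) [Fact (1 ≤ p)] : Submodule ℂ (lp (fun _ : ℕ => ℂ) p) :=
  Submodule.span ℂ (Set.range fun k : ℕ => lp.single p k (1 : ℂ))

theorem cell_mem_finSupp (n i : ℕ) : cell p n i ∈ finSupp p :=
  Submodule.smul_mem _ _ (Submodule.subset_span ⟨_, rfl⟩)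

theorem dense_finSupp (hp : p ≠ ∞) : Dense (finSupp p : Set (lp (fun _ : ℕ => ℂ) p)) := by
  intro x
  refine mem_closure_of_tendsto (lp.hasSum_single hp x) (Filter.Eventually.of_forall fun s => ?_)
  refine Submodule.sum_mem _ fun i _ => ?_
  have : lp.single (E := fun _ : ℕ => ℂ) p i (x i) = x i • lp.single p i (1 : ℂ) := by
    rw [← lp.single_smul, smul_eq_mul, mul_one]
  rw [this]
  exact Submodule.smul_mem _ _ (Submodule.subset_span ⟨i, rfl⟩)

theorem separableSpace_lp (hp : p ≠ ∞) :
    TopologicalSpace.SeparableSpace (lp (fun _ : ℕ => ℂ) p) := by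
  rw [← TopologicalSpace.isSeparable_univ_iff, ← (dense_finSupp hp).closure_eq]
  exact ((Set.countable_range _).isSeparable.span (R := ℂ)).closure

variable {T : lp (fun _ : ℕ => ℂ) p →L[ℂ] lp (fun _ : ℕ => ℂ) p}

theorem exists_preimage_of_mem_finSupp (hT : params.IsOperator T) (r : ℕ)
    {y : lp (fun _ : ℕ => ℂ) p} (hy : y ∈ finSupp p) :
    ∃ C : ℝ, ∀ᶠ k in Filter.atTop, (T ^ 2 ^ (expo k - r)) y = y ∧
      ∃ z ∈ finSupp p, (T ^ len k) z = y - z ∧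
        ‖z‖ * 2 ^ (ramp k - 8 * expo k) ≤ C := by
  induction hy using Submodule.span_induction with
  | mem x hx =>
    obtain ⟨j, rfl⟩ := hx
    obtain ⟨n, i, hi, rfl⟩ := exists_eq_blockStart_add j
    refine ⟨2 ^ i, ?_⟩
    filter_upwards [Filter.eventually_gt_atTop (expo n.size + r + n.size)] with k hk
    have hk' := le_expo k
    rw [single_eq_smul_cell]
    set c : ℂ := ((2 : ℂ) ^ min i (ramp n.size))⁻¹
    have hc : ‖c‖ ≤ 1 := by
      simp only [c, norm_inv, norm_pow, Complex.norm_ofNat]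
      exact inv_le_one_of_one_le₀ (one_le_pow₀ one_le_two)
    clear_value c
    -- The child of `n` at stage `k` is `2 ^ (k - 1) + n`; place `i` of it, divided by the gain,
    -- serves as `z`.
    have hn : n < 2 ^ (k - 1) := Nat.size_le.1 (by omega)
    have hs : (2 ^ (k - 1) + n).size = k := by rw [size_pow_add hn]; omega
    have hg : gain (2 ^ (k - 1) + n) = 2 ^ (ramp k - 8 * expo k) := by
      rw [gain_eq, hs]
      have : 0 < 2 ^ (k - 1) := by positivity
      omega
    have hg0 : (2 : ℂ) ^ (ramp k - 8 * expo k) ≠ 0 := pow_ne_zero _ two_ne_zero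
    have hik : i < len (2 ^ (k - 1) + n).size := by
      rw [hs]; exact hi.trans_le (len_strictMono.monotone (by omega))
    refine ⟨by rw [map_smul, iterate_two_pow_cell hT hi (by omega)],
      c • ((2 : ℂ) ^ (ramp k - 8 * expo k))⁻¹ • cell p (2 ^ (k - 1) + n) i,
      Submodule.smul_mem _ _ (Submodule.smul_mem _ _ (cell_mem_finSupp _ _)), ?_, ?_⟩
    · have := iterate_len_cell hT hik
      rw [hs, parent_pow_add hn, iterate_cell_zero hT hi, hg] at this
      rw [map_smul, map_smul, this, ← smul_sub, smul_add, smul_smul, inv_mul_cancel₀ hg0, one_smul,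
        smul_neg, neg_add_eq_sub]
    · rw [norm_smul, norm_smul, norm_cell, norm_inv, norm_pow, Complex.norm_ofNat, mul_assoc,
        mul_right_comm, inv_mul_cancel₀ (by positivity), one_mul]
      calc ‖c‖ * (2 : ℝ) ^ min i (ramp (2 ^ (k - 1) + n).size) ≤ 1 * 2 ^ i :=
            mul_le_mul hc (pow_le_pow_right₀ one_le_two (min_le_left _ _)) (by positivity)
              zero_le_one
        _ = 2 ^ i := one_mul _
  | zero =>
    refine ⟨0, Filter.Eventually.of_forall fun k => ⟨map_zero _, 0, Submodule.zero_mem _, ?_, ?_⟩⟩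
    · simp
    · simp
  | add x y _ _ hx hy =>
    obtain ⟨C, hC⟩ := hx
    obtain ⟨D, hD⟩ := hy
    refine ⟨C + D, ?_⟩
    filter_upwards [hC, hD] with k ⟨h1, z, hz, h2, h3⟩ ⟨h1', z', hz', h2', h3'⟩
    refine ⟨by rw [map_add, h1, h1'], z + z', Submodule.add_mem _ hz hz', ?_, ?_⟩
    · rw [map_add, h2, h2']; abel
    · refine le_trans (mul_le_mul_of_nonneg_right (norm_add_le z z') (by positivity)) ?_
      linarith
  | smul a x _ hx =>
    obtain ⟨C, hC⟩ := hx
    refine ⟨‖a‖ * C, ?_⟩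
    filter_upwards [hC] with k ⟨h1, z, hz, h2, h3⟩
    refine ⟨by rw [map_smul, h1], a • z, Submodule.smul_mem _ _ hz, ?_, ?_⟩
    · rw [map_smul, h2, smul_sub]
    · rw [norm_smul, mul_assoc]
      gcongr

theorem norm_iterate_le (T : lp (fun _ : ℕ => ℂ) p →L[ℂ] lp (fun _ : ℕ => ℂ) p) (m : ℕ)
    (x : lp (fun _ : ℕ => ℂ) p) : ‖(T ^ m) x‖ ≤ ‖T‖ ^ m * ‖x‖ := by
  induction m with
  | zero => simp
  | succ m ih =>
    rw [add_comm, iterate_add_apply, pow_one, add_comm 1 m, pow_succ', mul_assoc]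
    exact (T.le_opNorm _).trans (mul_le_mul_of_nonneg_left ih (norm_nonneg T))

theorem exists_hasToggles (hT : params.IsOperator T) :
    ∃ (q : ℕ) (H : ℕ → ℕ), 0 < q ∧ Filter.Tendsto H Filter.atTop Filter.atTop ∧
      HasToggles T (finSupp p) q H := by
  obtain ⟨s, hs⟩ := pow_unbounded_of_one_lt ‖T‖ (one_lt_two (α := ℝ))
  -- With `‖T‖ < 2 ^ s`, the growth in `len k / 2 ^ (s + 5)` steps is at most `2 ^ (len k / 32)`,
  -- while `‖z‖` is at most a constant times `2 ^ (-len k / 16)`.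
  refine ⟨2 ^ (s + 5), fun k => 2 ^ (expo k - (s + 5)), by positivity, ?_, ?_⟩
  · refine (tendsto_pow_atTop_atTop_of_one_lt one_lt_two).comp ?_
    exact (Filter.tendsto_sub_atTop_nat (s + 5)).comp expo_strictMono.tendsto_atTop
  · intro y hy ε hε
    obtain ⟨C, hC⟩ := exists_preimage_of_mem_finSupp hT (s + 5) hy
    have hlim : Filter.Tendsto (fun k : ℕ => C * (1 / 2 : ℝ) ^ k) Filter.atTop (nhds (C * 0)) :=
      (tendsto_pow_atTop_nhds_zero_of_lt_one (by norm_num) (by norm_num)).const_mul C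
    rw [mul_zero] at hlim
    filter_upwards [hC, hlim.eventually (ge_mem_nhds hε), Filter.eventually_ge_atTop (s + 5)]
      with k ⟨h1, z, hz, h2, h3⟩ hk1 hk2
    have hke := le_expo k
    have hqH : 2 ^ (s + 5) * 2 ^ (expo k - (s + 5)) = len k := by
      rw [← pow_add, len]; congr 1; omega
    refine ⟨h1, z, hz, by rw [hqH, h2], fun m hm => ?_⟩
    have h4 : s * 2 ^ (expo k - (s + 5)) + k ≤ ramp k - 8 * expo k := by
      have e1 := ramp_mul (show 1 ≤ k by omega)
      have e2 := mul_expo_le_ramp k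
      have e3 : s * 2 ^ (expo k - (s + 5)) ≤ 2 ^ s * 2 ^ (expo k - (s + 5)) :=
        Nat.mul_le_mul_right _ (Nat.lt_two_pow_self).le
      rw [pow_add, mul_right_comm] at hqH
      omega
    have h5 : ‖(T ^ m) z‖ ≤ 2 ^ (s * 2 ^ (expo k - (s + 5))) * ‖z‖ := by
      refine (norm_iterate_le T m z).trans (mul_le_mul_of_nonneg_right ?_ (norm_nonneg z))
      calc ‖T‖ ^ m ≤ (2 ^ s) ^ m := pow_le_pow_left₀ (norm_nonneg T) hs.le m
        _ = 2 ^ (s * m) := (pow_mul _ _ _).symm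
        _ ≤ _ := pow_le_pow_right₀ one_le_two (Nat.mul_le_mul_left s hm)
    refine h5.trans (le_trans ?_ hk1)
    rw [one_div, inv_pow, ← div_eq_mul_inv, le_div_iff₀ (by positivity)]
    refine le_trans ?_ h3
    rw [mul_right_comm, ← pow_add, mul_comm]
    gcongr
    exact one_le_two

end Positive

/-! ### A set of times along which the operator is not frequently hypercyclic -/

/-- The times that avoid, at every stage `k` and up to time `len k ^ 2`, the neighbourhoods of
the positive multiples of `len k`. -/
def avoidingTimes : Set ℕ :=
  {m | ∀ k, 1 ≤ k → ramp k ≤ m → m ≤ len k ^ 2 →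
    ramp k ≤ m % len k ∧ m % len k + ramp k ≤ len k}

theorem len_sq_lt (k : ℕ) : 2 * len k ^ 2 < ramp (k + 1) := by
  have h1 := ramp_mul (show 1 ≤ k + 1 by omega)
  have h2 : len (k + 1) = 2 ^ len k * 2 ^ 16 := by rw [len, expo_succ, pow_add]
  have h3 : len k ^ 2 ≤ 2 ^ len k * 4 := by
    have h4 : 2 * expo k ≤ len k + 2 := by
      rcases Nat.eq_zero_or_pos k with rfl | hk
      · simp [expo]
      · have := mul_expo_le_ramp k
        have := ramp_lt k
        omega
    calc len k ^ 2 = 2 ^ (2 * expo k) := by rw [len, ← pow_mul, mul_comm]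
      _ ≤ 2 ^ (len k + 2) := Nat.pow_le_pow_right (by norm_num) h4
      _ = 2 ^ len k * 4 := by rw [pow_add]; norm_num
  have h5 : 0 < 2 ^ len k := by positivity
  omega

/-- Earlier stages have expired and later ones have not begun, so stage `k + 1` alone matters. -/
theorem mem_avoidingTimes {k m : ℕ} (h1 : len k ^ 2 < m) (h2 : m < ramp (k + 1 + 1))
    (h3 : ramp (k + 1) ≤ m → ramp (k + 1) ≤ m % len (k + 1) ∧
      m % len (k + 1) + ramp (k + 1) ≤ len (k + 1)) : m ∈ avoidingTimes := by
  intro k' _ h5 h6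
  rcases lt_trichotomy k' (k + 1) with h | rfl | h
  · have h7 : len k' ≤ len k := len_strictMono.monotone (by omega)
    have h8 : len k' ^ 2 ≤ len k ^ 2 := Nat.pow_le_pow_left h7 2
    omega
  · exact h3 h5
  · have : ramp (k + 1 + 1) ≤ ramp k' := ramp_strictMono.monotone (by omega)
    omega

/-- Past `len (k + 1)` the residues in the middle six eighths are available; before it, almost all
of an initial interval is, since `len k ^ 2` is less than half of `ramp (k + 1)`. -/
theorem lowerDensity_avoidingTimes_pos : 0 < lowerDensity avoidingTimes := by
  refine lt_of_lt_of_le (show (0 : ℝ) < 1 / 16 by norm_num) (le_lowerDensity ?_)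
  filter_upwards [Filter.eventually_ge_atTop (ramp 1)] with N hN
  obtain ⟨k, hk, hN1, hN2⟩ := exists_le_lt_succ ramp_strictMono hN
  obtain ⟨k, rfl⟩ : ∃ k', k = k' + 1 := ⟨k - 1, by omega⟩
  have h8 := ramp_mul hk
  have hsq := len_sq_lt k
  rcases le_total (len (k + 1)) N with hle | hle
  · have := le_countBelow_of_periodic (S := avoidingTimes)
      (C := Finset.Ico (ramp (k + 1)) (7 * ramp (k + 1))) (N := N) (M := N) (len_pos (k + 1))
      (fun c hc => by rw [Finset.mem_Ico] at hc; omega)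
      (fun q c hc hq => by
        rw [Finset.mem_Ico] at hc
        rw [Nat.succ_mul] at hq
        have hmod : (q * len (k + 1) + c) % len (k + 1) = c := by
          rw [mul_comm, Nat.mul_add_mod]
          exact Nat.mod_eq_of_lt (by omega)
        refine mem_avoidingTimes (k := k) (by omega) (by omega)
          fun _ => ?_
        rw [hmod]
        omega) hle le_rfl
    refine le_trans ?_ this
    have hr : (0 : ℝ) < ramp (k + 1) := by
      have : 0 < ramp (k + 1) := by omega
      exact_mod_cast this
    have h8' : (len (k + 1) : ℝ) = ramp (k + 1) * 8 := by exact_mod_cast h8.symm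
    rw [Nat.card_Ico, h8', show 7 * ramp (k + 1) - ramp (k + 1) = 6 * ramp (k + 1) by omega]
    refine mul_le_mul_of_nonneg_right ?_ (Nat.cast_nonneg N)
    rw [le_div_iff₀ (mul_pos two_pos (mul_pos hr (by norm_num)))]
    push_cast
    linarith
  · have hpos : 0 < len k ^ 2 := pow_pos (len_pos k) 2
    have h1 : (Finset.Ico (len k ^ 2 + 1) (min N (6 * ramp (k + 1)))).card ≤
        countBelow avoidingTimes N := by
      refine card_le_countBelow fun m hm => ?_
      rw [Finset.mem_Ico] at hm
      refine ⟨mem_avoidingTimes (k := k) (by omega) (by omega)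
        fun hm' => ?_, by omega⟩
      rw [Nat.mod_eq_of_lt (by omega)]
      omega
    rw [Nat.card_Ico] at h1
    have h2 : N ≤ 16 * countBelow avoidingTimes N := by
      rcases Nat.lt_or_ge (ramp (k + 1)) 8 with h | h
      · have := mul_expo_le_ramp (k + 1)
        rw [expo_succ] at this
        omega
      · omega
    have h2' : (N : ℝ) ≤ 16 * countBelow avoidingTimes N := by exact_mod_cast h2
    linarith

theorem norm_sub_le_tsum_of_hasSum {f : ℕ → ℂ} {a : ℂ} (hf : HasSum f a) {g : ℕ → ℝ}
    (hg : Summable g) (hg0 : ∀ j, 0 ≤ g j) (j₀ : ℕ) (h : ∀ j, j ≠ j₀ → ‖f j‖ ≤ g j) :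
    ‖a - f j₀‖ ≤ ∑' j, g j := by
  refine (hasSum_ite_sub_hasSum hf j₀).norm_le_of_bounded hg.hasSum fun j => ?_
  split_ifs with hj
  · rw [norm_zero]; exact hg0 j
  · exact h j hj

theorem blockStart_add_lt {n i : ℕ} (hi : i < len n.size) :
    blockStart n + i + 1 ≤ 2 ^ (2 * expo n.size) := by
  have h1 : blockStart (n + 1) ≤ (n + 1) * len n.size := by
    have := Finset.sum_le_card_nsmul (Finset.range (n + 1)) (fun i => len i.size) (len n.size)
      (fun i hi => len_strictMono.monotone (Nat.size_le_size (by
        have := Finset.mem_range.1 hi; omega)))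
    rwa [Finset.card_range, smul_eq_mul] at this
  have h2 : (n + 1) * len n.size ≤ 2 ^ expo n.size * len n.size := by
    refine Nat.mul_le_mul_right _ ?_
    exact (lt_two_pow_size n).trans_le (Nat.pow_le_pow_right (by norm_num) (le_expo _))
  rw [two_mul, pow_add]
  rw [blockStart_succ] at h1
  change _ ≤ 2 ^ expo n.size * len n.size
  omega

/-- Errors of size `2 ^ (-4 * expo)` at each coordinate are therefore summable. -/
theorem inv_two_pow_le {n i : ℕ} (hi : i < len n.size) :
    ((2 : ℝ) ^ (4 * expo n.size))⁻¹ ≤ 1 / (((blockStart n + i : ℕ) : ℝ) + 1) ^ 2 := by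
  rw [inv_eq_one_div]
  refine one_div_le_one_div_of_le (by positivity) ?_
  have h : (((blockStart n + i : ℕ) : ℝ) + 1) ≤ 2 ^ (2 * expo n.size) := by
    exact_mod_cast blockStart_add_lt hi
  calc _ ≤ ((2 : ℝ) ^ (2 * expo n.size)) ^ 2 := by gcongr
    _ = 2 ^ (4 * expo n.size) := by rw [← pow_mul]; congr 1; ring

/-! ### Active coordinates and the dichotomy. -/

section Negative

variable {p : ℝ≥0∞} [Fact (1 ≤ p)] {T : lp (fun _ : ℕ => ℂ) p →L[ℂ] lp (fun _ : ℕ => ℂ) p}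

theorem hasSum_iterate_apply (hp : p ≠ ∞) (x : lp (fun _ : ℕ => ℂ) p) (m q : ℕ) :
    HasSum (fun j => x j * (T ^ m) (lp.single p j (1 : ℂ)) q) ((T ^ m) x q) := by
  have h : HasSum (fun j => (T ^ m) (lp.single p j (x j)) q) ((T ^ m) x q) :=
    (lp.hasSum_single hp x).mapL ((lp.evalCLM ℂ (fun _ : ℕ => ℂ) p q).comp (T ^ m))
  convert h using 2 with j
  have : lp.single (E := fun _ : ℕ => ℂ) p j (x j) = x j • lp.single p j (1 : ℂ) := by
    rw [← lp.single_smul, smul_eq_mul, mul_one]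
  rw [this, map_smul]
  rfl

theorem norm_apply_le (x : lp (fun _ : ℕ => ℂ) p) (j : ℕ) : ‖x j‖ ≤ ‖x‖ :=
  lp.norm_apply_le_norm (zero_lt_one.trans_le (Fact.out : 1 ≤ p)).ne' x j

/-- The coordinates of the orbit of a basis vector. -/
theorem iterate_single_apply (hT : params.IsOperator T) {n i : ℕ} (hi : i < len n.size) (m : ℕ) :
    ∃ s t : ℂ, ‖s‖ = 1 ∧ ‖t‖ ≤ 1 ∧ (i + m < len n.size → t = 0) ∧
      ∀ q, (T ^ m) (lp.single p (blockStart n + i) (1 : ℂ)) q * 2 ^ min i (ramp n.size) =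
        s * cell p n ((i + m) % len n.size) q +
          t * gain n * (T ^ ((i + m) % len n.size)) (cell p (parent n) 0) q := by
  obtain ⟨s, t, hs, ht, ht0, h⟩ := iterate_cell hT hi m
  refine ⟨s, t, hs, ht, ht0, fun q => ?_⟩
  have h2 : (2 : ℂ) ^ min i (ramp n.size) ≠ 0 := pow_ne_zero _ two_ne_zero
  rw [single_eq_smul_cell, map_smul, h, lp.coeFn_smul, Pi.smul_apply, smul_eq_mul, mul_comm,
    mul_inv_cancel_left₀ h2]
  rfl

/-- The parent orbit is bounded by `2 ^ expo n.size`, because `expo` exceeds the length of the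
preceding stage; this uses up one of the eight factors in the gain. -/
theorem norm_gain_mul_le (hT : params.IsOperator T) (n m q : ℕ) :
    ‖gain n * (T ^ m) (cell p (parent n) 0) q‖ ≤ 2 ^ ramp n.size * (2 ^ (7 * expo n.size))⁻¹ := by
  rcases Nat.eq_zero_or_pos n with rfl | hn
  · rw [gain, if_pos rfl, zero_mul, norm_zero]; positivity
  · have h1 : ‖(T ^ m) (cell p (parent n) 0) q‖ ≤ 2 ^ expo n.size := by
      refine (norm_apply_le _ _).trans ((norm_iterate_cell_zero_le hT _ _).trans ?_)
      refine pow_le_pow_right₀ one_le_two ?_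
      have h2 := size_parent_lt hn
      have h3 : len (parent n).size ≤ len (n.size - 1) := len_strictMono.monotone (by omega)
      have h4 : expo n.size = len (n.size - 1) + 16 := by
        rw [← expo_succ]; congr 1; omega
      omega
    have h5 : ramp n.size - 8 * expo n.size + expo n.size + 7 * expo n.size = ramp n.size := by
      have := mul_expo_le_ramp n.size
      omega
    rw [norm_mul, ← div_eq_mul_inv, le_div_iff₀ (by positivity)]
    calc ‖gain n‖ * ‖(T ^ m) (cell p (parent n) 0) q‖ * 2 ^ (7 * expo n.size)
        ≤ 2 ^ (ramp n.size - 8 * expo n.size) * 2 ^ expo n.size * 2 ^ (7 * expo n.size) := by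
          gcongr
          exact norm_gain_le n
      _ = 2 ^ ramp n.size := by rw [← pow_add, ← pow_add, h5]

/-- The coordinates of the orbit of a basis vector, away from its block. -/
theorem norm_iterate_single_apply_le (hT : params.IsOperator T) {n i m q : ℕ}
    (hi : i < len n.size) (hq : q ≠ blockStart n + (i + m) % len n.size) :
    ‖(T ^ m) (lp.single p (blockStart n + i) (1 : ℂ)) q‖ * 2 ^ min i (ramp n.size) ≤
      2 ^ ramp n.size * (2 ^ (7 * expo n.size))⁻¹ := by
  obtain ⟨s, t, -, ht, -, h⟩ := iterate_single_apply hT hi m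
  have h1 := congrArg norm (h q)
  rw [norm_mul, norm_pow, Complex.norm_ofNat] at h1
  rw [h1, cell_apply_ne _ _ hq, mul_zero, zero_add, mul_assoc, norm_mul]
  exact (mul_le_of_le_one_left (norm_nonneg _) ht).trans (norm_gain_mul_le hT _ _ _)

theorem iterate_single_apply_eq_zero (hT : params.IsOperator T) {n i m q : ℕ}
    (hi : i < len n.size) (hq : q ≠ blockStart n + (i + m) % len n.size)
    (h : i + m < len n.size ∨ blockStart (parent n + 1) ≤ q) :
    (T ^ m) (lp.single p (blockStart n + i) (1 : ℂ)) q = 0 := by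
  obtain ⟨s, t, -, -, ht, h'⟩ := iterate_single_apply hT hi m
  have h2 : (2 : ℂ) ^ min i (ramp n.size) ≠ 0 := pow_ne_zero _ two_ne_zero
  refine (mul_eq_zero.1 ?_).resolve_right h2
  rw [h' q, cell_apply_ne _ _ hq, mul_zero, zero_add]
  rcases h with h | h
  · rw [ht h, zero_mul, zero_mul]
  · rw [iterate_cell_zero_apply_eq_zero hT h, mul_zero]

/-- The coordinate of `x` at place `i` of block `n` is large enough to have an effect on the
parent block. -/
def IsActive (x : lp (fun _ : ℕ => ℂ) p) (n i : ℕ) : Prop :=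
  i < len n.size ∧
    2 ^ (3 * expo n.size) * 2 ^ min i (ramp n.size) ≤ ‖x (blockStart n + i)‖ * 2 ^ ramp n.size

/-- On the flat part, activity would force a coordinate larger than the norm of `x`. -/
theorem IsActive.lt_ramp {x : lp (fun _ : ℕ => ℂ) p} {n i : ℕ} (h : IsActive x n i)
    (hn : 1 ≤ n.size) (hx : ‖x‖ ≤ 2 ^ expo n.size) : i < ramp n.size := by
  by_contra hi
  have h1 := h.2
  rw [min_eq_right (by omega)] at h1
  have h2 : (2 : ℝ) ^ (3 * expo n.size) ≤ ‖x (blockStart n + i)‖ :=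
    le_of_mul_le_mul_right h1 (by positivity)
  have h3 : (2 : ℝ) ^ (3 * expo n.size) ≤ 2 ^ expo n.size :=
    h2.trans ((norm_apply_le _ _).trans hx)
  have h4 := (pow_le_pow_iff_right₀ (one_lt_two (α := ℝ))).1 h3
  have h5 := le_expo_of_pos hn
  omega

theorem parent_lt_of_size_eq {n n' : ℕ} (hn : 1 ≤ n) (h : n'.size = n.size) : parent n' < n := by
  have h0 : 0 < n.size := Nat.size_pos.2 hn
  have h1 : 2 ^ (n.size - 1) ≤ n := Nat.lt_size.1 (by omega)
  have h2 := lt_two_pow_size n'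
  have h3 : 2 ^ n.size = 2 ^ (n.size - 1) * 2 := by rw [← pow_succ, Nat.sub_add_cancel h0]
  rw [parent]
  rw [h] at h2 ⊢
  omega

theorem mod_add_ne {L i i' m : ℕ} (hi : i < L) (hi' : i' < L) (h : i' ≠ i) :
    (i' + m) % L ≠ (i + m) % L := fun heq =>
  h (by
    have := Nat.ModEq.add_right_cancel' m heq
    rwa [Nat.ModEq, Nat.mod_eq_of_lt hi, Nat.mod_eq_of_lt hi'] at this)

/-- Outside the block of an active coordinate, the other coordinates of `x` have little influence
on that block for a long time. -/
theorem norm_mul_iterate_single_apply_le (hT : params.IsOperator T)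
    {x : lp (fun _ : ℕ => ℂ) p} {n i m : ℕ} (hn : 1 ≤ n) (hi : i < len n.size)
    (hm : m ≤ len n.size ^ 2) (hx : ‖x‖ ≤ 2 ^ expo n.size) {j : ℕ}
    (hj : j ≠ blockStart n + i) :
    ‖x j * (T ^ m) (lp.single p j (1 : ℂ)) (blockStart n + (i + m) % len n.size)‖ ≤
      (2 ^ (2 * expo n.size))⁻¹ * (1 / ((j : ℝ) + 1) ^ 2) := by
  obtain ⟨n', i', hi', rfl⟩ := exists_eq_blockStart_add j
  set q := blockStart n + (i + m) % len n.size with hq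
  have hr : (i + m) % len n.size < len n.size := Nat.mod_lt _ (len_pos _)
  have hr' : (i' + m) % len n'.size < len n'.size := Nat.mod_lt _ (len_pos _)
  have hpos : (0 : ℝ) ≤ (2 ^ (2 * expo n.size))⁻¹ *
      (1 / (((blockStart n' + i' : ℕ) : ℝ) + 1) ^ 2) := by positivity
  have hqne : q ≠ blockStart n' + (i' + m) % len n'.size := by
    intro heq
    have h1 : n' = n := by rw [← blockOf_add hr', ← heq, hq, blockOf_add hr]
    subst h1
    exact mod_add_ne hi hi' (fun h => hj (by rw [h])) (Nat.add_left_cancel (hq ▸ heq)).symm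
  rcases Nat.lt_or_ge n.size n'.size with hs | hs
  · rcases Nat.lt_or_ge (i' + m) (len n'.size) with him | him
    · rw [iterate_single_apply_eq_zero hT hi' hqne (Or.inl him), mul_zero, norm_zero]
      exact hpos
    -- A block of a later stage feeds only after a completed turn. As `m ≤ len n.size ^ 2` is
    -- shorter than its ramp, the coordinate started on the flat part, where the fed amount is
    -- negligible.
    · have h1 : ramp n'.size ≤ i' := by
        have h2 := len_sq_lt n.size
        have h3 : ramp (n.size + 1) ≤ ramp n'.size := ramp_strictMono.monotone hs
        have h4 := ramp_mul (show 1 ≤ n'.size by omega)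
        omega
      have h2 := norm_iterate_single_apply_le hT hi' hqne
      rw [min_eq_right h1, mul_comm] at h2
      have h3 := le_of_mul_le_mul_left h2 (by positivity)
      have h4 : expo n.size ≤ expo n'.size := expo_strictMono.monotone hs.le
      rw [norm_mul]
      calc _ ≤ 2 ^ expo n.size * (2 ^ (7 * expo n'.size) : ℝ)⁻¹ :=
            mul_le_mul ((norm_apply_le _ _).trans hx) h3 (norm_nonneg _) (by positivity)
        _ = 2 ^ expo n.size * (2 ^ (3 * expo n'.size) : ℝ)⁻¹ * (2 ^ (4 * expo n'.size))⁻¹ := by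
            rw [mul_assoc, ← mul_inv, ← pow_add]; congr 3; ring
        _ ≤ (2 ^ (2 * expo n.size))⁻¹ * (1 / (((blockStart n' + i' : ℕ) : ℝ) + 1) ^ 2) := by
            refine mul_le_mul ?_ (inv_two_pow_le hi') (by positivity) (by positivity)
            rw [← div_eq_mul_inv, div_le_iff₀ (by positivity), inv_mul_eq_div,
              le_div_iff₀ (by positivity), ← pow_add]
            exact pow_le_pow_right₀ one_le_two (by omega)
  -- Blocks of the same or an earlier stage feed only blocks of index below `n`.
  · have hlow : blockStart (parent n' + 1) ≤ q := by
      refine le_trans (blockStart_strictMono.monotone ?_) (Nat.le_add_right _ _)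
      rcases eq_or_lt_of_le hs with h | h
      · exact parent_lt_of_size_eq hn h
      · have h5 : n' < n := by
          by_contra hlt
          have := Nat.size_le_size (not_lt.1 hlt)
          omega
        have : parent n' ≤ n' := Nat.sub_le _ _
        omega
    rw [iterate_single_apply_eq_zero hT hi' hqne (Or.inr hlow), mul_zero, norm_zero]
    exact hpos

/-- At its position on the flat part the active coordinate contributes at least `2 ^ (3 * expo
n.size)`, and all the others together at most `1`. -/
theorem IsActive.one_le_norm_iterate (hp : p ≠ ∞) (hT : params.IsOperator T)
    {x : lp (fun _ : ℕ => ℂ) p} {n i m : ℕ} (h : IsActive x n i) (hn : 1 ≤ n)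
    (hx : ‖x‖ ≤ 2 ^ expo n.size) (hS : ∑' j : ℕ, 1 / ((j : ℝ) + 1) ^ 2 ≤ 2 ^ expo n.size)
    (hm : m ≤ len n.size ^ 2) (hr : ramp n.size ≤ (i + m) % len n.size) : 1 ≤ ‖(T ^ m) x‖ := by
  obtain ⟨hi, hact⟩ := h
  have h1 := norm_sub_le_tsum_of_hasSum (hasSum_iterate_apply (T := T) hp x m
    (blockStart n + (i + m) % len n.size))
    (summable_one_div_succ_sq.mul_left ((2 ^ (2 * expo n.size) : ℝ)⁻¹)) (fun j => by positivity)
    (blockStart n + i) (fun j hj => norm_mul_iterate_single_apply_le hT hn hi hm hx hj)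
  rw [tsum_mul_left] at h1
  have h2 : (2 ^ (2 * expo n.size) : ℝ)⁻¹ * ∑' j : ℕ, 1 / ((j : ℝ) + 1) ^ 2 ≤ 1 := by
    rw [inv_mul_eq_div, div_le_one (by positivity)]
    exact hS.trans (pow_le_pow_right₀ one_le_two (by omega))
  have h3 : 2 ^ (3 * expo n.size) ≤ ‖x (blockStart n + i) *
      (T ^ m) (lp.single p (blockStart n + i) (1 : ℂ)) (blockStart n + (i + m) % len n.size)‖ := by
    obtain ⟨s, t, hs, -, -, h4⟩ := iterate_single_apply hT hi m
    have h5 := h4 (blockStart n + (i + m) % len n.size)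
    rw [cell_apply_self, iterate_cell_zero_apply_eq_zero hT, mul_zero, add_zero,
      min_eq_right hr] at h5
    · have h6 := congrArg norm h5
      rw [norm_mul, norm_mul, hs, one_mul, norm_pow, norm_pow, Complex.norm_ofNat] at h6
      rw [norm_mul]
      refine le_of_mul_le_mul_right ?_
        (show (0 : ℝ) < 2 ^ min i (ramp n.size) by positivity)
      rwa [mul_assoc, h6]
    · exact (blockStart_strictMono.monotone (parent_lt hn)).trans (Nat.le_add_right _ _)
  have h4 : (2 : ℝ) ≤ 2 ^ (3 * expo n.size) := by
    have := le_expo_of_pos (Nat.size_pos.2 hn)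
    exact le_self_pow₀ one_le_two (by omega)
  have h5 := norm_apply_le ((T ^ m) x) (blockStart n + (i + m) % len n.size)
  have h6 := norm_sub_norm_le (x (blockStart n + i) *
      (T ^ m) (lp.single p (blockStart n + i) (1 : ℂ)) (blockStart n + (i + m) % len n.size))
      ((T ^ m) x (blockStart n + (i + m) % len n.size))
  rw [norm_sub_rev] at h6
  linarith

/-- The two margins in `avoidingTimes` fit together with `i < ramp n.size`: the lower one puts `i +
m % len n.size` past the ramp, the upper one prevents it from wrapping around. -/
theorem IsActive.lt_ramp_of_mem (hp : p ≠ ∞) (hT : params.IsOperator T)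
    {x : lp (fun _ : ℕ => ℂ) p} {n i m : ℕ} (h : IsActive x n i) (hn : 1 ≤ n)
    (hx : ‖x‖ ≤ 2 ^ expo n.size) (hS : ∑' j : ℕ, 1 / ((j : ℝ) + 1) ^ 2 ≤ 2 ^ expo n.size)
    (hm : m ≤ len n.size ^ 2) (hmA : m ∈ avoidingTimes) (hmx : ‖(T ^ m) x‖ < 1) :
    m < ramp n.size := by
  by_contra hlt
  have hsz : 1 ≤ n.size := Nat.size_pos.2 hn
  obtain ⟨h1, h2⟩ := hmA n.size hsz (not_lt.1 hlt) hm
  have hi := h.lt_ramp hsz hx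
  have h3 : (i + m) % len n.size = i + m % len n.size := by
    rw [Nat.add_mod, Nat.mod_eq_of_lt h.1, Nat.mod_eq_of_lt (by omega)]
  exact absurd hmx (not_lt.2 (h.one_le_norm_iterate hp hT hn hx hS hm (by omega)))

/-- The first `2 ^ k₀` blocks have bounded orbits. Later blocks reach coordinate `0` only through
what they feed, and inactivity bounds this by `2 ^ (3 * expo - 7 * expo)`, which is summable. -/
theorem exists_bound_of_not_isActive (hp : p ≠ ∞) (hT : params.IsOperator T)
    {x : lp (fun _ : ℕ => ℂ) p} {k₀ : ℕ} (h : ∀ n i, k₀ ≤ n.size → ¬ IsActive x n i) :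
    ∃ M : ℝ, ∀ m, ‖(T ^ m) x 0‖ ≤ M := by
  set B := blockStart (2 ^ k₀) with hB
  have hfin : Summable fun j : ℕ => if j < B then ‖x‖ * 2 ^ len k₀ else 0 :=
    summable_of_ne_finset_zero (s := Finset.range B) fun j hj => by
      rw [if_neg (by simpa using hj)]
  refine ⟨∑' j : ℕ, ((if j < B then ‖x‖ * 2 ^ len k₀ else 0) + 1 / ((j : ℝ) + 1) ^ 2), fun m => ?_⟩
  refine (hasSum_iterate_apply hp x m 0).norm_le_of_bounded
    (hfin.add summable_one_div_succ_sq).hasSum fun j => ?_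
  obtain ⟨n, i, hi, rfl⟩ := exists_eq_blockStart_add j
  rcases Nat.lt_or_ge n (2 ^ k₀) with hn | hn
  · have h1 : blockStart n + i < B := by
      have := blockStart_strictMono.monotone (show n + 1 ≤ 2 ^ k₀ from hn)
      rw [blockStart_succ] at this
      omega
    rw [if_pos h1, norm_mul]
    refine le_add_of_le_of_nonneg ?_ (by positivity)
    refine mul_le_mul (norm_apply_le _ _) ?_ (norm_nonneg _) (norm_nonneg _)
    refine (norm_apply_le _ _).trans ?_
    rw [single_eq_smul_cell, map_smul, norm_smul, norm_inv, norm_pow, Complex.norm_ofNat,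
      ← iterate_cell_zero hT hi, ← iterate_add_apply]
    refine (mul_le_of_le_one_left (norm_nonneg _)
      (inv_le_one_of_one_le₀ (one_le_pow₀ one_le_two))).trans ?_
    refine (norm_iterate_cell_zero_le hT _ _).trans (pow_le_pow_right₀ one_le_two ?_)
    exact len_strictMono.monotone (Nat.size_le.2 hn)
  · have hn1 : 1 ≤ n := Nat.one_le_two_pow.trans hn
    have hs : k₀ < n.size := Nat.lt_size.2 hn
    refine le_add_of_nonneg_of_le (by split_ifs <;> positivity) ?_
    have hb : 0 < blockStart n := blockStart_strictMono hn1
    have h1 := norm_iterate_single_apply_le hT (m := m) (q := 0) hi (by omega)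
    have h2 : ‖x (blockStart n + i)‖ * 2 ^ ramp n.size <
        2 ^ (3 * expo n.size) * 2 ^ min i (ramp n.size) := by
      by_contra hlt
      exact h n i hs.le ⟨hi, not_lt.1 hlt⟩
    refine le_trans ?_ (inv_two_pow_le hi)
    rw [norm_mul]
    generalize ‖(T ^ m) (lp.single p (blockStart n + i) (1 : ℂ)) 0‖ = u at h1 ⊢
    have hpos : (0 : ℝ) < 2 ^ min i (ramp n.size) := by positivity
    refine le_of_mul_le_mul_right ?_ hpos
    calc ‖x (blockStart n + i)‖ * u * 2 ^ min i (ramp n.size)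
        = ‖x (blockStart n + i)‖ * (u * 2 ^ min i (ramp n.size)) := by ring
      _ ≤ ‖x (blockStart n + i)‖ * (2 ^ ramp n.size * (2 ^ (7 * expo n.size))⁻¹) := by gcongr
      _ = ‖x (blockStart n + i)‖ * 2 ^ ramp n.size * (2 ^ (7 * expo n.size))⁻¹ := by ring
      _ ≤ 2 ^ (3 * expo n.size) * 2 ^ min i (ramp n.size) * (2 ^ (7 * expo n.size))⁻¹ := by gcongr
      _ = (2 ^ (4 * expo n.size))⁻¹ * 2 ^ min i (ramp n.size) := by
          rw [show 7 * expo n.size = 3 * expo n.size + 4 * expo n.size by ring, pow_add]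
          field_simp

theorem lowerDensity_inter_le_zero (hp : p ≠ ∞) (hT : params.IsOperator T)
    {x : lp (fun _ : ℕ => ℂ) p} (h : ∀ k₀ : ℕ, ∃ n i, k₀ ≤ n.size ∧ IsActive x n i) :
    lowerDensity (avoidingTimes ∩ visitSet T x (Metric.ball 0 1)) ≤ 0 := by
  refine le_of_forall_pos_le_add fun c hc => ?_
  rw [zero_add]
  refine lowerDensity_le (Filter.frequently_atTop.2 fun a => ?_)
  obtain ⟨k₀, hk₀⟩ := exists_nat_gt
    (max (max ‖x‖ (∑' j : ℕ, 1 / ((j : ℝ) + 1) ^ 2)) (max (a : ℝ) (1 / c)))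
  simp only [max_lt_iff] at hk₀
  obtain ⟨⟨hkx, hkS⟩, hka, hkc⟩ := hk₀
  obtain ⟨n, i, hn, hact⟩ := h (k₀ + 1)
  have hk : (k₀ : ℝ) ≤ 2 ^ expo n.size := by
    have h1 : k₀ < 2 ^ k₀ := Nat.lt_two_pow_self
    have h2 : 2 ^ k₀ ≤ 2 ^ expo n.size :=
      Nat.pow_le_pow_right (by norm_num) ((le_trans (by omega) hn).trans (le_expo _))
    exact_mod_cast h1.le.trans h2
  have hlen : (len n.size : ℝ) = 2 ^ expo n.size := by simp [len]
  have hn1 : 1 ≤ n := Nat.size_pos.1 (by omega)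
  have hcount : countBelow (avoidingTimes ∩ visitSet T x (Metric.ball 0 1)) (len n.size ^ 2) ≤
      ramp n.size := by
    obtain ⟨C, hC, hCmem⟩ := exists_finset_countBelow
      (avoidingTimes ∩ visitSet T x (Metric.ball 0 1)) (len n.size ^ 2)
    rw [← hC]
    have : C ⊆ Finset.range (ramp n.size) := fun m hm => by
      obtain ⟨⟨h1, h2⟩, h3⟩ := hCmem m hm
      exact Finset.mem_range.2 (hact.lt_ramp_of_mem hp hT hn1 (hkx.le.trans hk) (hkS.le.trans hk)
        h3.le h1 (mem_ball_zero_iff.1 h2))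
    simpa using Finset.card_le_card this
  -- At most `len n.size` visits occur before time `len n.size ^ 2`, a proportion below `c`.
  refine ⟨len n.size ^ 2, ?_, ?_⟩
  · have h1 : (a : ℝ) ≤ len n.size := by rw [hlen]; exact hka.le.trans hk
    have h2 : a ≤ len n.size := by exact_mod_cast h1
    exact h2.trans (Nat.le_self_pow two_ne_zero _)
  · have h1 : (countBelow (avoidingTimes ∩ visitSet T x (Metric.ball 0 1)) (len n.size ^ 2) : ℝ) ≤
        len n.size := by exact_mod_cast hcount.trans (ramp_lt _).le
    refine h1.trans ?_
    have h2 : 1 / c ≤ len n.size := by rw [hlen]; exact hkc.le.trans hk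
    rw [div_le_iff₀ hc] at h2
    push_cast
    nlinarith [(Nat.cast_nonneg (len n.size) : (0 : ℝ) ≤ len n.size)]

theorem not_isFrequentlyHypercyclicAlong (hp : p ≠ ∞) (hT : params.IsOperator T) :
    ¬ IsFrequentlyHypercyclicAlong T avoidingTimes := by
  rintro ⟨x, hx⟩
  by_cases h : ∀ k₀ : ℕ, ∃ n i, k₀ ≤ n.size ∧ IsActive x n i
  · exact absurd (hx _ Metric.isOpen_ball (Metric.nonempty_ball.2 one_pos))
      (not_lt.2 (lowerDensity_inter_le_zero hp hT h))
  · push Not at h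
    obtain ⟨k₀, hk₀⟩ := h
    obtain ⟨M, hM⟩ := exists_bound_of_not_isActive hp hT hk₀
    -- This open set is never visited when coordinate `0` is bounded along the orbit.
    have hopen : IsOpen {y : lp (fun _ : ℕ => ℂ) p | M < ‖y 0‖} :=
      isOpen_lt continuous_const (lp.evalCLM ℂ (fun _ : ℕ => ℂ) p 0).continuous.norm
    have hM0 : 0 ≤ M := (norm_nonneg _).trans (hM 0)
    have hne : {y : lp (fun _ : ℕ => ℂ) p | M < ‖y 0‖}.Nonempty := by
      refine ⟨lp.single p 0 ((M + 1 : ℝ) : ℂ), ?_⟩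
      show M < ‖lp.single (E := fun _ : ℕ => ℂ) p 0 ((M + 1 : ℝ) : ℂ) 0‖
      rw [lp.single_apply_self, Complex.norm_real, Real.norm_eq_abs, abs_of_pos (by linarith)]
      linarith
    obtain ⟨m, -, hm⟩ := nonempty_of_lowerDensity_pos (hx _ hopen hne)
    exact absurd hm (not_lt.2 (hM m))

end Negative
end LinDyn

theorem mainTheorem6 (p : ℝ≥0∞) [Fact (1 ≤ p)] (hp : p ≠ ∞) :
    ∃ (T : lp (fun _ : ℕ => ℂ) p →L[ℂ] lp (fun _ : ℕ => ℂ) p) (A : Set ℕ),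
      LinDyn.IsCPlusOneType T ∧
      0 < LinDyn.lowerDensity A ∧
      LinDyn.IsFrequentlyHypercyclic T ∧
      LinDyn.IsChaotic T ∧
      ¬ LinDyn.IsFrequentlyHypercyclicAlong T A ∧
      ¬ LinDyn.IsHereditarilyFrequentlyHypercyclic T := by
  obtain ⟨T, hT⟩ := LinDyn.exists_isOperator hp
  obtain ⟨q, H, hq, hH, htog⟩ := LinDyn.exists_hasToggles hT
  have hdense := LinDyn.dense_finSupp hp
  have := LinDyn.separableSpace_lp hp
  have hfhc := htog.isFrequentlyHypercyclic hq hH hdense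
  have hnot := LinDyn.not_isFrequentlyHypercyclicAlong hp hT
  exact ⟨T, LinDyn.avoidingTimes, ⟨LinDyn.params, hT⟩, LinDyn.lowerDensity_avoidingTimes_pos, hfhc,
    ⟨hfhc.isHypercyclic, htog.dense_periodic hH hdense⟩, hnot,
    fun h => hnot (h.isFrequentlyHypercyclicAlong LinDyn.lowerDensity_avoidingTimes_pos)⟩
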